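/- Theorem 2.1. Let $\xi_0,\xi_1,\xi_2,\dots$ be i.i.d. complex-valued random variables having a density $p:\mathbb{C}\to[0,\infty)$ with respect to Lebesgue measure, where $p$ is continuous on some open set $\mathcal{D}\subset\mathbb{C}$ and vanishes on $\mathbb{C}\setminus\mathcal{D}$. Let $$Q_n(z)=\prod_{k=0}^n (z-\xi_k),\qquad f(z)=\mathbb{E}\left[\frac{1}{z-\xi_1}\right],$$ and suppose that $f(z)\neq 0$ for Lebesgue-a.e. $z\in\mathcal{D}$ (the expectation defining $f$ exists at every point of $\mathcal{D}$). Let $r_1,r_2,\dots>0$ be a sequence of positive numbers with $$\lim_{n\to\infty} n r_n=+\infty\quad\text{and}\quad \lim_{n\to\infty}\sqrt{n}\,r_n=0 .$$ Write $\bar{\mathbb{B}}_{r}(u)=\{z\in\mathbb{C}:|z-u|\le r\}$. (a) We have $$\lim_{n\to\infty}\mathbb{P}\left[\text{there is a unique } \zeta\in\bar{\mathbb{B}}_{r_n}(\xi_0)\text{ such that } Q_n'(\zeta)=0\right]=1 .$$ (b) Let $\zeta_n$, $n\in\mathbb{N}$, be complex random variables such that $\zeta_n$ is the unique zero of $Q_n'$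 in $\bar{\mathbb{B}}_{r_n}(\xi_0)$ whenever there is exactly one such zero; otherwise $\zeta_n$ may be defined arbitrarily. Then $$\frac{f^2(\xi_0)}{\sqrt{\pi p(\xi_0)}}\sqrt{\frac{n}{\log n}}\left(n(\zeta_n-\xi_0)+\frac{1}{f(\xi_0)}\right)\xrightarrow[n\to\infty]{d}\mathcal{N}_{\mathbb{C}}(0,1),$$ where $\mathcal{N}_{\mathbb{C}}(0,1)$ is the law of a complex random variable whose real and imaginary parts are independent real Gaussian variables with mean $0$ and variance $1/2$. -/

import Mathlib

open MeasureTheory ProbabilityTheory Filter Topology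
open scoped NNReal

noncomputable section

/-- The centred complex normal distribution with variance `v`: the law of `A + i B`, where `A` and
`B` are independent real Gaussian variables with mean `0` and variance `v / 2`. -/
def complexNormal (v : ℝ≥0) : Measure ℂ :=
  ((gaussianReal 0 (v / 2)).prod (gaussianReal 0 (v / 2))).map
    (fun x : ℝ × ℝ => (x.1 : ℂ) + (x.2 : ℂ) * Complex.I)

instance (v : ℝ≥0) : IsProbabilityMeasure (complexNormal v) :=
  Measure.isProbabilityMeasure_map (by fun_prop)

/-- The Cauchy–Stieltjes transform `z ↦ 𝔼[1 / (z - X)]` of a complex random variable `X`.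
Where the expectation does not exist the Bochner integral returns the junk value `0`. -/
def cauchyStieltjes {Ω : Type*} [MeasurableSpace Ω] (P : Measure Ω) (X : Ω → ℂ) (z : ℂ) : ℂ :=
  ∫ ω, 1 / (z - X ω) ∂P

/-- The polynomial `∏_{k=0}^n (z - a_k)`. -/
def polyOfZeros (a : ℕ → ℂ) (n : ℕ) : Polynomial ℂ :=
  ∏ k ∈ Finset.range (n + 1), (Polynomial.X - Polynomial.C (a k))

/-- `ζ` is a critical point of `∏_{k=0}^n (z - a_k)` lying in the closed disk of radius `r`
centred at the zero `a_0`. -/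
def IsCriticalPointNear (a : ℕ → ℂ) (n : ℕ) (r : ℝ) (ζ : ℂ) : Prop :=
  ζ ∈ Metric.closedBall (a 0) r ∧ (polyOfZeros a n).derivative.eval ζ = 0

end

/-! Fix `ξ 0 = u` and put `S(z) = ∑ 1/(z - ξ_k)` over `1 ≤ k ≤ n`. Away from the other zeros,
logarithmic differentiation turns `Q_n'(z) = 0` into `(z - u) S(z) = -1`, that is, `z` is a fixed
point of `z ↦ u - 1/S(z)`. The law of large numbers gives `S(u) ≈ n f(u)`. The condition `√n r_n →
0` keeps the other zeros out of the disk of radius `2 r_n`, and `∑ 1/|u - ξ_k|^2` is at most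
`n^(5/4)` with high probability, so `S` stays near `n f(u)` on the whole disk. The condition `n r_n
→ ∞` makes the disk large enough to contain `u - 1/S(z)`. The map is then a contraction of the disk,
which yields part (a): see `existsUnique_isCriticalPointNear` and
`tendsto_measureReal_not_isTypical`.

For part (b), `ζ - u = -1/S(ζ)`, and `S(ζ) - S(u)` is of order at most `n^(1/4)`, negligible against
`√(n log n)`. The rescaled quantity is therefore `n f(u)/S(ζ)`, which tends to `1`, times the
normalized fluctuation of `S(u)`, up to a vanishing error
(`IsTypical.norm_sub_one_le_and_norm_sub_le`).

The variable `1/(u - ξ)` has tail `P(|1/(u - ξ)| > R) ~ π p(u)/R^2`, so its variance is infinite,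
but only logarithmically. Truncation at `|u - ξ| = 1/√n` gives a central limit theorem with
normalization `√(π p(u) n log n)` (`tendsto_integral_exp_inner_inv_sub_pow`). After this
normalization the limit no longer depends on `u`, so Fubini and dominated convergence remove the
conditioning (`tendsto_integral_of_indepFun`), and Slutsky's theorem concludes. -/

/-! ### Radial integrals against a locally bounded density -/

section DensityBounds

open Metric Set
open scoped RealInnerProductSpace

lemma integral_norm_sub_eq (h : ℝ → ℝ) (u : ℂ) :
    ∫ x : ℂ, h ‖x - u‖ = 2 * Real.pi * ∫ y in Ioi (0 : ℝ), y * h y := by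
  rw [integral_sub_right_eq_self (fun x : ℂ => h ‖x‖) u,
    integral_fun_norm_addHaar (volume : Measure ℂ) h]
  simp [measureReal_def, Complex.volume_ball, Complex.finrank_real_complex, mul_assoc]

lemma integrable_norm_sub_iff (h : ℝ → ℝ) (u : ℂ) :
    Integrable (fun x : ℂ => h ‖x - u‖) ↔ IntegrableOn (fun y : ℝ => y * h y) (Ioi 0) := by
  have h1 : Integrable (fun x : ℂ => h ‖x - u‖) ↔ Integrable (fun x : ℂ => h ‖x‖) :=
    ⟨fun H => by simpa using H.comp_add_right u, fun H => H.comp_sub_right u⟩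
  rw [h1, integrable_fun_norm_addHaar (volume : Measure ℂ)]
  simp [Complex.finrank_real_complex]

lemma restrict_withDensity_le {p : ℂ → ℝ} {s : Set ℂ} {M : ℝ} (hs : MeasurableSet s)
    (hM : ∀ x ∈ s, p x ≤ M) :
    (volume.withDensity fun z => ENNReal.ofReal (p z)).restrict s ≤
      ENNReal.ofReal M • volume.restrict s := by
  rw [restrict_withDensity hs, ← withDensity_const]
  refine withDensity_mono ?_
  filter_upwards [ae_restrict_mem hs] with x hx
  exact ENNReal.ofReal_le_ofReal (hM x hx)

/-- On the ball the measure is at most `M` times Lebesgue measure, so polar coordinates apply; off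
the ball the integrand is at most `C` and the total mass is one. All moment bounds for the kernel
`1/(u - x)` come from suitable choices of `h`. -/
lemma integrable_and_integral_le_of_density_le {p : ℂ → ℝ} {μ : Measure ℂ} [IsProbabilityMeasure μ]
    (hμ : μ = volume.withDensity fun z => ENNReal.ofReal (p z)) {u : ℂ} {δ M C : ℝ}
    (hM0 : 0 ≤ M) (hM : ∀ x ∈ ball u δ, p x ≤ M) {h : ℝ → ℝ} (hh : Measurable h)
    (h0 : ∀ y, 0 ≤ h y) (hC0 : 0 ≤ C) (hC : ∀ y, δ ≤ y → h y ≤ C)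
    (hint : IntegrableOn (fun y => y * h y) (Ioo 0 δ)) :
    Integrable (fun x => h ‖x - u‖) μ ∧
      ∫ x, h ‖x - u‖ ∂μ ≤ M * (2 * Real.pi * ∫ y in Ioo 0 δ, y * h y) + C := by
  have hmeas : Measurable fun x : ℂ => h ‖x - u‖ := by fun_prop
  have hind : (fun x : ℂ => (Iio δ).indicator h ‖x - u‖)
      = (ball u δ).indicator fun x => h ‖x - u‖ := by
    ext x
    simp [indicator, dist_eq_norm]
  have hind' : (fun y : ℝ => y * (Iio δ).indicator h y) = (Iio δ).indicator fun y => y * h y := by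
    ext y
    by_cases hy : y ∈ Iio δ <;> simp [hy]
  have hIoo : Iio δ ∩ Ioi 0 = Ioo 0 δ := by ext; simp [and_comm]
  have hI : IntegrableOn (fun x : ℂ => h ‖x - u‖) (ball u δ) := by
    rw [← integrable_indicator_iff measurableSet_ball, ← hind,
      integrable_norm_sub_iff ((Iio δ).indicator h) u, hind',
      integrableOn_indicator_iff measurableSet_Iio, hIoo]
    exact hint
  have hE : ∫ x in ball u δ, h ‖x - u‖ = 2 * Real.pi * ∫ y in Ioo 0 δ, y * h y := by
    rw [← integral_indicator measurableSet_ball, ← hind,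
      integral_norm_sub_eq ((Iio δ).indicator h) u, hind',
      setIntegral_indicator measurableSet_Iio, inter_comm, hIoo]
  have hle := hμ ▸ restrict_withDensity_le measurableSet_ball hM
  have hI' : Integrable (fun x : ℂ => h ‖x - u‖) (ENNReal.ofReal M • volume.restrict (ball u δ)) :=
    hI.integrable.smul_measure ENNReal.ofReal_ne_top
  have h1 : IntegrableOn (fun x => h ‖x - u‖) (ball u δ) μ := hI'.mono_measure hle
  have hb : ∀ x ∈ (ball u δ)ᶜ, h ‖x - u‖ ≤ C := fun x hx => hC _ (by
    simpa [dist_eq_norm] using hx)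
  have h2 : IntegrableOn (fun x => h ‖x - u‖) (ball u δ)ᶜ μ := by
    refine Measure.integrableOn_of_bounded (M := C) (measure_ne_top _ _)
      hmeas.aestronglyMeasurable ?_
    filter_upwards [ae_restrict_mem measurableSet_ball.compl] with x hx
    rw [Real.norm_of_nonneg (h0 _)]
    exact hb x hx
  have h3 : Integrable (fun x => h ‖x - u‖) μ := by
    rw [← integrableOn_univ, ← union_compl_self (ball u δ)]
    exact h1.union h2
  refine ⟨h3, ?_⟩
  rw [← integral_add_compl measurableSet_ball h3]
  refine add_le_add ?_ ?_
  · refine (integral_mono_measure hle (ae_of_all _ fun x => h0 _) hI').trans ?_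
    rw [integral_smul_measure, hE, ENNReal.toReal_ofReal hM0, smul_eq_mul]
  · calc ∫ x in (ball u δ)ᶜ, h ‖x - u‖ ∂μ ≤ ∫ x in (ball u δ)ᶜ, C ∂μ :=
          setIntegral_mono_on h2 (integrable_const _) measurableSet_ball.compl hb
      _ = μ.real (ball u δ)ᶜ * C := by simp
      _ ≤ 1 * C := by gcongr; exact measureReal_le_one
      _ = C := one_mul C

end DensityBounds

/-! ### Logarithmic growth of the truncated second moment -/

section TruncatedVariance

open Metric Set
open scoped RealInnerProductSpace

lemma measurableSet_annulus (s δ : ℝ) (u : ℂ) :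
    MeasurableSet {x : ℂ | s ≤ ‖x - u‖ ∧ ‖x - u‖ < δ} := by
  have h1 : MeasurableSet {x : ℂ | s ≤ ‖x - u‖} := measurableSet_le (by fun_prop) (by fun_prop)
  have h2 : MeasurableSet {x : ℂ | ‖x - u‖ < δ} := measurableSet_lt (by fun_prop) (by fun_prop)
  exact h1.inter h2

lemma norm_inner_sq_le (z t : ℂ) : ⟪z, t⟫ ^ 2 ≤ ‖t‖ ^ 2 * ‖z‖ ^ 2 := by
  rw [← mul_pow, ← sq_abs]
  have := abs_real_inner_le_norm z t
  gcongr
  linarith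

/-- Pythagoras: `z` and `-i z` are orthogonal and of equal length. -/
lemma inner_sq_add_inner_I_mul_sq (z t : ℂ) :
    ⟪z, t⟫ ^ 2 + ⟪-Complex.I * z, t⟫ ^ 2 = ‖t‖ ^ 2 * ‖z‖ ^ 2 := by
  simp only [Complex.inner, Complex.sq_norm, Complex.normSq_apply]
  simp
  ring

lemma integrableOn_annulus_inner_inv_sq {s δ : ℝ} (hs : 0 < s) (u t : ℂ) :
    IntegrableOn (fun x : ℂ => ⟪(u - x)⁻¹, t⟫ ^ 2) {x | s ≤ ‖x - u‖ ∧ ‖x - u‖ < δ} := by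
  have hmS : MeasurableSet {x : ℂ | s ≤ ‖x - u‖ ∧ ‖x - u‖ < δ} :=
    measurableSet_annulus s δ u
  refine Measure.integrableOn_of_bounded (M := ‖t‖ ^ 2 * (s⁻¹) ^ 2) ?_ (by fun_prop) ?_
  · refine ((measure_mono (t := ball u δ) ?_).trans_lt measure_ball_lt_top).ne
    intro x hx
    simpa [dist_eq_norm] using hx.2
  · filter_upwards [ae_restrict_mem hmS] with x hx
    rw [Real.norm_of_nonneg (sq_nonneg _)]
    refine (norm_inner_sq_le _ _).trans ?_
    rw [norm_inv, norm_sub_rev]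
    have := hx.1
    gcongr

/-- By rotation invariance every direction contributes equally, so the integral is half of `‖t‖ ^ 2
∫ ‖x - u‖⁻²`, and the radial integral is `2π log (δ / s)`. -/
lemma integral_annulus_inner_inv_sq {s δ : ℝ} (hs : 0 < s) (hsδ : s ≤ δ) (u t : ℂ) :
    ∫ x in {x | s ≤ ‖x - u‖ ∧ ‖x - u‖ < δ}, ⟪(u - x)⁻¹, t⟫ ^ 2
      = Real.pi * ‖t‖ ^ 2 * Real.log (δ / s) := by
  set S : Set ℂ := {x | s ≤ ‖x - u‖ ∧ ‖x - u‖ < δ} with hS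
  have hmS : MeasurableSet S :=
    measurableSet_annulus s δ u
  let S₀ : Set ℂ := {x | s ≤ ‖x‖ ∧ ‖x‖ < δ}
  have hmS₀ : MeasurableSet S₀ := by
    simpa only [sub_zero] using measurableSet_annulus s δ 0
  have hshift : ∀ g : ℂ → ℝ, ∫ x in S, g (x - u) = ∫ x in S₀, g x := by
    intro g
    rw [← integral_indicator hmS, ← integral_indicator hmS₀,
      ← integral_sub_right_eq_self (S₀.indicator g) u]
    rfl
  have hI1 := integrableOn_annulus_inner_inv_sq (δ := δ) hs u t
  have hI2 : IntegrableOn (fun x : ℂ => ⟪-Complex.I * (u - x)⁻¹, t⟫ ^ 2) S := by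
    refine (integrableOn_annulus_inner_inv_sq (δ := δ) hs u (Complex.I * t)).congr_fun ?_ hmS
    intro x _
    simp only [Complex.inner]
    simp
    ring
  -- The substitution `v ↦ i v` in `v = x - u` preserves both the annulus and Lebesgue measure, and
  -- exchanges the two orthogonal components of the kernel.
  have hrot : ∫ x in S, ⟪-Complex.I * (u - x)⁻¹, t⟫ ^ 2 = ∫ x in S, ⟪(u - x)⁻¹, t⟫ ^ 2 := by
    have e1 := hshift fun v => ⟪-Complex.I * (-v)⁻¹, t⟫ ^ 2
    have e2 := hshift fun v => ⟪(-v)⁻¹, t⟫ ^ 2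
    simp only [neg_sub] at e1 e2
    rw [e1, e2]
    let e : ℂ ≃ₗᵢ[ℝ] ℂ := (rotation ⟨Complex.I, by simp [Submonoid.unitSphere]⟩)
    have he : ∀ v, e v = Complex.I * v := fun v => rfl
    have hp := e.measurePreserving
    rw [← hp.setIntegral_preimage_emb e.toHomeomorph.measurableEmbedding _ S₀]
    have : e ⁻¹' S₀ = S₀ := by
      ext v
      simp [S₀]
    rw [this]
    refine integral_congr_ae (ae_of_all _ fun v => ?_)
    simp [he]
    ring
  have hsum : 2 * ∫ x in S, ⟪(u - x)⁻¹, t⟫ ^ 2 = ‖t‖ ^ 2 * ∫ x in S, (‖x - u‖ ^ 2)⁻¹ := by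
    rw [two_mul]
    nth_rewrite 2 [← hrot]
    rw [← integral_add hI1 hI2, ← integral_const_mul]
    refine integral_congr_ae (ae_of_all _ fun x => ?_)
    simp only
    rw [inner_sq_add_inner_I_mul_sq, norm_inv, norm_sub_rev, inv_pow]
  have hrad : ∫ x in S, (‖x - u‖ ^ 2)⁻¹ = 2 * Real.pi * Real.log (δ / s) := by
    have h1 : S.indicator (fun x => (‖x - u‖ ^ 2)⁻¹)
        = fun x => (Ico s δ).indicator (fun y : ℝ => (y ^ 2)⁻¹) ‖x - u‖ := by
      ext x
      simp [indicator, S]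
    rw [← integral_indicator hmS, h1, integral_norm_sub_eq]
    congr 1
    have h2 : (fun y : ℝ => y * (Ico s δ).indicator (fun y : ℝ => (y ^ 2)⁻¹) y)
        = (Ico s δ).indicator fun y => y⁻¹ := by
      ext y
      by_cases hy : y ∈ Ico s δ
      · have : y ≠ 0 := (hs.trans_le hy.1).ne'
        simp only [hy, indicator_of_mem]
        field_simp
      · simp [hy]
    have hsub : Ico s δ ⊆ Ioi 0 := fun y hy => hs.trans_le hy.1
    rw [h2, setIntegral_indicator measurableSet_Ico,
      inter_eq_right.2 hsub, integral_Ico_eq_integral_Ioc,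
      ← intervalIntegral.integral_of_le hsδ, integral_inv_of_pos hs (hs.trans_le hsδ)]
  rw [hrad] at hsum
  linarith

/-- Near `u` the density is within `ε` of `p u`, so the annulus formula gives the main term `π p(u)
‖t‖² log (1/s)`; the region far from `u` contributes a bounded amount, which the logarithm absorbs.
-/
lemma tendsto_truncated_second_moment {p : ℂ → ℝ} (hp0 : ∀ z, 0 ≤ p z) (hpm : Measurable p)
    {μ : Measure ℂ} [IsProbabilityMeasure μ]
    (hμ : μ = volume.withDensity fun z => ENNReal.ofReal (p z)) {u : ℂ} (hu : ContinuousAt p u)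
    (t : ℂ) :
    Tendsto (fun s : ℝ => (∫ x in {x | s ≤ ‖x - u‖}, ⟪(u - x)⁻¹, t⟫ ^ 2 ∂μ) / Real.log s⁻¹)
      (𝓝[>] 0) (𝓝 (Real.pi * p u * ‖t‖ ^ 2)) := by
  set q : ℂ → ℝ := fun x => ⟪(u - x)⁻¹, t⟫ ^ 2 with hq
  have hqm : Measurable q := by fun_prop
  have hq0 : ∀ x, 0 ≤ q x := fun x => sq_nonneg _
  have hlog : Tendsto (fun s : ℝ => Real.log s⁻¹) (𝓝[>] 0) atTop :=
    Real.tendsto_log_atTop.comp tendsto_inv_nhdsGT_zero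
  -- `K` may depend on `ε` through `δ`, but not on `s`, so it vanishes after division by `log s⁻¹`.
  have key : ∀ ε > 0, ∃ K : ℝ, ∀ᶠ s in 𝓝[>] (0 : ℝ),
      |(∫ x in {x | s ≤ ‖x - u‖}, q x ∂μ) - Real.pi * p u * ‖t‖ ^ 2 * Real.log s⁻¹|
        ≤ ε * (Real.pi * ‖t‖ ^ 2) * Real.log s⁻¹ + K := by
    intro ε hε
    obtain ⟨δ, hδ, hclose⟩ := Metric.continuousAt_iff.1 hu ε hε
    set L := Real.pi * ‖t‖ ^ 2 with hL
    have hL0 : 0 ≤ L := by positivity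
    refine ⟨ε * L * |Real.log δ| + p u * L * |Real.log δ| + ‖t‖ ^ 2 * (δ⁻¹) ^ 2, ?_⟩
    filter_upwards [Ioo_mem_nhdsGT hδ] with s hs
    set S : Set ℂ := {x | s ≤ ‖x - u‖ ∧ ‖x - u‖ < δ} with hS
    have hmS : MeasurableSet S :=
    measurableSet_annulus s δ u
    have hmO : MeasurableSet {x : ℂ | δ ≤ ‖x - u‖} := measurableSet_le (by fun_prop) (by fun_prop)
    have hsplit : {x : ℂ | s ≤ ‖x - u‖} = S ∪ {x | δ ≤ ‖x - u‖} := by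
      ext x
      simp only [mem_ofPred_eq, mem_union, hS]
      constructor
      · intro h
        rcases lt_or_ge ‖x - u‖ δ with h' | h'
        · exact Or.inl ⟨h, h'⟩
        · exact Or.inr h'
      · rintro (h | h)
        · exact h.1
        · exact hs.2.le.trans h
    have hbd : ∀ r : ℝ, 0 < r → ∀ x : ℂ, r ≤ ‖x - u‖ → q x ≤ ‖t‖ ^ 2 * (r⁻¹) ^ 2 := by
      intro r hr x hx
      refine (norm_inner_sq_le _ _).trans ?_
      rw [norm_inv, norm_sub_rev]
      gcongr
    have hint : ∀ r : ℝ, 0 < r → IntegrableOn q {x | r ≤ ‖x - u‖} μ := by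
      intro r hr
      refine Measure.integrableOn_of_bounded (M := ‖t‖ ^ 2 * (r⁻¹) ^ 2) (measure_ne_top _ _)
        hqm.aestronglyMeasurable ?_
      filter_upwards [ae_restrict_mem (measurableSet_le (by fun_prop) (by fun_prop))] with x hx
      rw [Real.norm_of_nonneg (hq0 x)]
      exact hbd r hr x hx
    have hdisj : Disjoint S {x | δ ≤ ‖x - u‖} :=
      Set.disjoint_left.2 fun x hx hx' => (not_lt.2 hx') hx.2
    have hIS : IntegrableOn q S μ := (hint s hs.1).mono_set fun x hx => hx.1
    rw [hsplit, setIntegral_union hdisj hmO hIS (hint δ hδ)]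
    have hJ := integral_annulus_inner_inv_sq hs.1 hs.2.le u t
    have hIS' := integrableOn_annulus_inner_inv_sq (δ := δ) hs.1 u t
    have hconv : ∫ x in S, q x ∂μ = ∫ x in S, p x * q x := by
      rw [hμ, restrict_withDensity hmS, integral_withDensity_eq_integral_toReal_smul
        (by fun_prop) (by simp)]
      simp [hp0]
    have hpS : ∀ x ∈ S, |p x - p u| ≤ ε := by
      intro x hx
      have := @hclose x (by simpa [dist_eq_norm] using hx.2)
      rw [Real.dist_eq] at this
      exact this.le
    have hIpq : IntegrableOn (fun x => p x * q x) S := by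
      refine (hIS'.const_mul (p u + ε)).mono' (by fun_prop) ?_
      filter_upwards [ae_restrict_mem hmS] with x hx
      rw [Real.norm_of_nonneg (mul_nonneg (hp0 x) (hq0 x))]
      have := abs_le.1 (hpS x hx)
      exact mul_le_mul_of_nonneg_right (by linarith) (hq0 x)
    have hmain : |(∫ x in S, q x ∂μ) - p u * (L * Real.log (δ / s))|
        ≤ ε * (L * Real.log (δ / s)) := by
      rw [hconv, ← hJ, ← integral_const_mul, ← integral_const_mul, ← integral_sub hIpq
        (hIS'.const_mul _)]
      refine (norm_integral_le_of_norm_le (f := fun x => p x * q x - p u * q x)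
        (hIS'.const_mul ε) ?_)
      filter_upwards [ae_restrict_mem hmS] with x hx
      change ‖p x * q x - p u * q x‖ ≤ ε * q x
      rw [← sub_mul, norm_mul, Real.norm_of_nonneg (hq0 x)]
      exact mul_le_mul_of_nonneg_right (hpS x hx) (hq0 x)
    have hout0 : 0 ≤ ∫ x in {x | δ ≤ ‖x - u‖}, q x ∂μ := integral_nonneg hq0
    have hout : ∫ x in {x | δ ≤ ‖x - u‖}, q x ∂μ ≤ ‖t‖ ^ 2 * (δ⁻¹) ^ 2 := by
      calc ∫ x in {x | δ ≤ ‖x - u‖}, q x ∂μ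
          ≤ ∫ x in {x | δ ≤ ‖x - u‖}, ‖t‖ ^ 2 * (δ⁻¹) ^ 2 ∂μ :=
            setIntegral_mono_on (hint δ hδ) (integrable_const _) hmO fun x hx => hbd δ hδ x hx
        _ = μ.real {x | δ ≤ ‖x - u‖} * (‖t‖ ^ 2 * (δ⁻¹) ^ 2) := by simp
        _ ≤ 1 * (‖t‖ ^ 2 * (δ⁻¹) ^ 2) := by gcongr; exact measureReal_le_one
        _ = _ := one_mul _
    have hlg : Real.log (δ / s) = Real.log δ + Real.log s⁻¹ := by
      rw [div_eq_mul_inv, Real.log_mul hδ.ne' (inv_pos.2 hs.1).ne']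
    rw [hlg] at hmain
    have h1 : ε * L * Real.log δ ≤ ε * L * |Real.log δ| :=
      mul_le_mul_of_nonneg_left (le_abs_self _) (by positivity)
    have h2 : |p u * L * Real.log δ| ≤ p u * L * |Real.log δ| := by
      rw [abs_mul, abs_of_nonneg (mul_nonneg (hp0 u) hL0)]
    have h2' := abs_le.1 h2
    have h3 := abs_le.1 hmain
    have : Real.pi * p u * ‖t‖ ^ 2 * Real.log s⁻¹ = p u * L * Real.log s⁻¹ := by rw [hL]; ring
    rw [this, abs_le]
    constructor <;> nlinarith
  rw [Metric.tendsto_nhds]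
  intro η hη
  have hLp : 0 < Real.pi * ‖t‖ ^ 2 + 1 := by positivity
  obtain ⟨K, hK⟩ := key (η / 2 / (Real.pi * ‖t‖ ^ 2 + 1)) (by positivity)
  filter_upwards [hK, hlog.eventually_gt_atTop (2 * |K| / η + 1)] with s hs hl
  have hl0 : 0 < Real.log s⁻¹ := lt_trans (by positivity) hl
  rw [Real.dist_eq, div_sub' hl0.ne', abs_div, abs_of_pos hl0, div_lt_iff₀ hl0, mul_comm (Real.log _)]
  refine hs.trans_lt ?_
  have h1 : η / 2 / (Real.pi * ‖t‖ ^ 2 + 1) * (Real.pi * ‖t‖ ^ 2) ≤ η / 2 := by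
    rw [div_mul_eq_mul_div, div_le_iff₀ hLp]
    nlinarith
  have h2 : K < η / 2 * Real.log s⁻¹ := by
    have : |K| < η / 2 * Real.log s⁻¹ := by
      have h4 : 2 * |K| / η < Real.log s⁻¹ := by linarith
      rw [div_lt_iff₀ hη] at h4
      linarith
    exact (le_abs_self K).trans_lt this
  nlinarith

end TruncatedVariance

/-! ### A central limit theorem with truncation -/

section TruncatedCLT

open Set

lemma norm_exp_mul_I_sub_sub_le (x : ℝ) :
    ‖Complex.exp (x * Complex.I) - 1 - x * Complex.I‖ ≤ 2 * |x| := by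
  have h1 : ‖Complex.exp (x * Complex.I) - 1‖ ≤ |x| := by
    have := Real.norm_exp_I_mul_ofReal_sub_one_le (x := x)
    rwa [mul_comm, Real.norm_eq_abs] at this
  have h2 : ‖(x : ℂ) * Complex.I‖ = |x| := by simp
  calc _ ≤ ‖Complex.exp (x * Complex.I) - 1‖ + ‖(x : ℂ) * Complex.I‖ := norm_sub_le _ _
    _ ≤ 2 * |x| := by rw [h2]; linarith

/-- The second-order bound serves on the truncated part; the cruder bound
`norm_exp_mul_I_sub_sub_le` needs only a first moment and serves off it. -/
lemma norm_exp_mul_I_sub_sub_add_le (x : ℝ) :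
    ‖Complex.exp (x * Complex.I) - 1 - x * Complex.I + (x ^ 2 / 2 : ℝ)‖ ≤ 3 * |x| ^ 3 := by
  -- For `|x| ≤ 1` this is Taylor's theorem; for `|x| > 1` lower powers of `|x|` are dominated by
  -- the cube.
  rcases le_or_gt |x| 1 with h | h
  · have hx : ‖(x : ℂ) * Complex.I‖ = |x| := by simp
    have := Complex.exp_bound (x := x * Complex.I) (by rw [hx]; exact h) (n := 3) (by norm_num)
    have e : ∑ m ∈ Finset.range 3, ((x : ℂ) * Complex.I) ^ m / (m.factorial : ℂ)
        = 1 + x * Complex.I - (x ^ 2 / 2 : ℝ) := by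
      simp [Finset.sum_range_succ, mul_pow]
      ring
    rw [e, hx] at this
    have e2 : Complex.exp (x * Complex.I) - 1 - x * Complex.I + (x ^ 2 / 2 : ℝ)
        = Complex.exp (x * Complex.I) - (1 + x * Complex.I - (x ^ 2 / 2 : ℝ)) := by ring
    rw [e2]
    refine this.trans ?_
    rw [mul_comm]
    gcongr
    norm_num [Nat.factorial]
  · have h1 := norm_exp_mul_I_sub_sub_le x
    have h2 : ‖((x ^ 2 / 2 : ℝ) : ℂ)‖ = |x| ^ 2 / 2 := by
      rw [Complex.norm_real, Real.norm_of_nonneg (by positivity), sq_abs]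
    refine (norm_add_le _ _).trans ?_
    rw [h2]
    have h3 : |x| ≤ |x| ^ 3 := by nlinarith [sq_nonneg (|x| - 1)]
    have h4 : |x| ^ 2 ≤ |x| ^ 3 := by nlinarith [sq_nonneg (|x|)]
    linarith

/-- A central limit theorem for triangular arrays with a truncation level, stated in terms of
characteristic functions. -/
lemma tendsto_integral_exp_pow_of_truncation {E : Type*} [MeasurableSpace E] {μ : Measure E}
    [IsProbabilityMeasure μ] {X : E → ℝ} (hXm : Measurable X) (hX : Integrable X μ)
    (hX0 : ∫ x, X x ∂μ = 0) {A : ℕ → Set E} (hA : ∀ n, MeasurableSet (A n)) {a : ℕ → ℝ}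
    (ha : ∀ᶠ n in atTop, 0 < a n) {σ : ℝ}
    (hA3 : ∀ᶠ n in atTop, IntegrableOn (fun x => |X x| ^ 3) (A n) μ)
    (h2 : Tendsto (fun n => n / a n ^ 2 * ∫ x in A n, X x ^ 2 ∂μ) atTop (𝓝 σ))
    (h3 : Tendsto (fun n => n / a n ^ 3 * ∫ x in A n, |X x| ^ 3 ∂μ) atTop (𝓝 0))
    (h1 : Tendsto (fun n => n / a n * ∫ x in (A n)ᶜ, |X x| ∂μ) atTop (𝓝 0)) :
    Tendsto (fun n : ℕ => (∫ x, Complex.exp ((X x / a n : ℝ) * Complex.I) ∂μ) ^ n) atTop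
      (𝓝 (Complex.exp (-(σ / 2 : ℝ)))) := by
  -- Since `X` has mean zero, the linear term can be subtracted for free. The integral is then split
  -- over `A n` and its complement, with a quadratic correction on `A n` only.
  have key : ∀ᶠ n : ℕ in atTop,
      ‖(n : ℂ) * ((∫ x, Complex.exp ((X x / a n : ℝ) * Complex.I) ∂μ) - 1)
        + ((n / a n ^ 2 * ∫ x in A n, X x ^ 2 ∂μ) / 2 : ℝ)‖
      ≤ 3 * (n / a n ^ 3 * ∫ x in A n, |X x| ^ 3 ∂μ)
        + 2 * (n / a n * ∫ x in (A n)ᶜ, |X x| ∂μ) := by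
    filter_upwards [ha, hA3] with n han hn3
    set b := a n with hb
    set G : E → ℂ := fun x => Complex.exp ((X x / b : ℝ) * Complex.I) - 1
      - (X x / b : ℝ) * Complex.I with hG
    have hIe : Integrable (fun x => Complex.exp ((X x / b : ℝ) * Complex.I)) μ := by
      refine (integrable_const (1 : ℝ)).mono' (by fun_prop) (ae_of_all _ fun x => ?_)
      rw [Complex.norm_exp_ofReal_mul_I]
    have hIX : Integrable (fun x => ((X x / b : ℝ) : ℂ) * Complex.I) μ :=
      ((hX.div_const b).ofReal).mul_const _
    have hIe1 : Integrable (fun x => Complex.exp ((X x / b : ℝ) * Complex.I) - 1) μ :=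
      hIe.sub (integrable_const 1)
    have hIG : Integrable G μ := hIe1.sub hIX
    have e1 : (∫ x, Complex.exp ((X x / b : ℝ) * Complex.I) ∂μ) - 1 = ∫ x, G x ∂μ := by
      simp only [hG]
      rw [integral_sub hIe1 hIX, integral_sub hIe (integrable_const _),
        integral_mul_const, integral_complex_ofReal, integral_div, hX0]
      simp
    -- Integrability of the square follows from `y ^ 2 ≤ y ^ 3 + 1` for `y ≥ 0`.
    have hI2 : IntegrableOn (fun x => X x ^ 2) (A n) μ := by
      refine (hn3.add (integrable_const (1 : ℝ))).mono' (by fun_prop) (ae_of_all _ fun x => ?_)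
      simp only [Pi.add_apply]
      rw [Real.norm_of_nonneg (sq_nonneg _), ← sq_abs]
      nlinarith [abs_nonneg (X x), sq_nonneg (|X x| - 1), mul_nonneg (abs_nonneg (X x))
        (sq_nonneg (|X x| - 1))]
    have hI2' : IntegrableOn (fun x => (((X x / b) ^ 2 / 2 : ℝ) : ℂ)) (A n) μ := by
      simp_rw [div_pow]
      exact ((hI2.div_const _).div_const _).ofReal
    have e2 : ∫ x in A n, G x ∂μ = (∫ x in A n, (G x + ((X x / b) ^ 2 / 2 : ℝ)) ∂μ)
        - ((1 / b ^ 2 * ∫ x in A n, X x ^ 2 ∂μ) / 2 : ℝ) := by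
      rw [integral_add hIG.integrableOn hI2', integral_complex_ofReal]
      simp_rw [div_pow]
      rw [integral_div, integral_div]
      push_cast
      ring
    have b1 : ‖∫ x in A n, (G x + ((X x / b) ^ 2 / 2 : ℝ)) ∂μ‖
        ≤ 3 * (1 / b ^ 3 * ∫ x in A n, |X x| ^ 3 ∂μ) := by
      rw [← integral_const_mul, ← integral_const_mul]
      refine norm_integral_le_of_norm_le ((hn3.const_mul _).const_mul _) (ae_of_all _ fun x => ?_)
      refine (norm_exp_mul_I_sub_sub_add_le (X x / b)).trans_eq ?_
      rw [abs_div, abs_of_pos han, div_pow]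
      ring
    have b2 : ‖∫ x in (A n)ᶜ, G x ∂μ‖ ≤ 2 * (1 / b * ∫ x in (A n)ᶜ, |X x| ∂μ) := by
      rw [← integral_const_mul, ← integral_const_mul]
      refine norm_integral_le_of_norm_le ((hX.abs.integrableOn.const_mul _).const_mul _)
        (ae_of_all _ fun x => ?_)
      refine (norm_exp_mul_I_sub_sub_le (X x / b)).trans_eq ?_
      rw [abs_div, abs_of_pos han]
      ring
    rw [e1, ← integral_add_compl (hA n) hIG, e2]
    have e3 : (n : ℂ) * ((∫ x in A n, (G x + ((X x / b) ^ 2 / 2 : ℝ)) ∂μ)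
          - ((1 / b ^ 2 * ∫ x in A n, X x ^ 2 ∂μ) / 2 : ℝ) + ∫ x in (A n)ᶜ, G x ∂μ)
        + ((n / b ^ 2 * ∫ x in A n, X x ^ 2 ∂μ) / 2 : ℝ)
        = n * (∫ x in A n, (G x + ((X x / b) ^ 2 / 2 : ℝ)) ∂μ)
          + n * ∫ x in (A n)ᶜ, G x ∂μ := by
      push_cast
      ring
    rw [e3]
    refine (norm_add_le _ _).trans ?_
    rw [norm_mul, norm_mul, Complex.norm_natCast]
    have hn0 : (0 : ℝ) ≤ n := n.cast_nonneg
    calc _ ≤ n * (3 * (1 / b ^ 3 * ∫ x in A n, |X x| ^ 3 ∂μ))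
          + n * (2 * (1 / b * ∫ x in (A n)ᶜ, |X x| ∂μ)) := by gcongr
      _ = _ := by ring
  have hz : Tendsto (fun n : ℕ =>
      (n : ℂ) * ((∫ x, Complex.exp ((X x / a n : ℝ) * Complex.I) ∂μ) - 1)
        + ((n / a n ^ 2 * ∫ x in A n, X x ^ 2 ∂μ) / 2 : ℝ)) atTop (𝓝 0) := by
    refine squeeze_zero_norm' key ?_
    simpa using (h3.const_mul 3).add (h1.const_mul 2)
  have hs : Tendsto (fun n : ℕ => (((n / a n ^ 2 * ∫ x in A n, X x ^ 2 ∂μ) / 2 : ℝ) : ℂ)) atTop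
      (𝓝 ((σ / 2 : ℝ) : ℂ)) :=
    (Complex.continuous_ofReal.tendsto _).comp (h2.div_const 2)
  have hlim := hz.sub hs
  simp only [add_sub_cancel_right, zero_sub] at hlim
  refine (Complex.tendsto_one_add_pow_exp_of_tendsto hlim).congr fun n => ?_
  rw [add_sub_cancel]

end TruncatedCLT

/-! ### Moments of the kernel `1/(u - x)`, inside and outside a small disk -/

section CauchyKernelMoments

open Metric Set
open scoped RealInnerProductSpace

lemma exists_density_le_of_continuousAt {p : ℂ → ℝ} (hp0 : ∀ z, 0 ≤ p z) {u : ℂ}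
    (hu : ContinuousAt p u) : ∃ δ > 0, ∃ M ≥ 0, ∀ x ∈ ball u δ, p x ≤ M := by
  obtain ⟨δ, hδ, h⟩ := Metric.continuousAt_iff.1 hu 1 one_pos
  refine ⟨δ, hδ, p u + 1, by linarith [hp0 u], fun x hx => ?_⟩
  have := h hx
  rw [Real.dist_eq] at this
  linarith [(abs_lt.1 this).2]

variable {p : ℂ → ℝ} {μ : Measure ℂ} {u : ℂ} {δ M s : ℝ}

lemma measureReal_closedBall_le (hμ : μ = volume.withDensity fun z => ENNReal.ofReal (p z))
    (hM0 : 0 ≤ M) (hM : ∀ x ∈ ball u δ, p x ≤ M) (hs0 : 0 ≤ s) (hs : s < δ) :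
    μ.real (closedBall u s) ≤ M * (Real.pi * s ^ 2) := by
  have h := restrict_withDensity_le (s := closedBall u s) measurableSet_closedBall
    fun x hx => hM x (closedBall_subset_ball hs hx)
  rw [← hμ] at h
  have h1 := h (closedBall u s)
  rw [Measure.restrict_apply_self] at h1
  simp only [Measure.smul_apply, Measure.restrict_apply_self, Complex.volume_closedBall,
    smul_eq_mul] at h1
  have h2 := ENNReal.toReal_mono (by finiteness) h1
  rw [measureReal_def]
  refine h2.trans_eq ?_
  rw [ENNReal.toReal_mul, ENNReal.toReal_mul, ENNReal.toReal_ofReal hM0, ENNReal.toReal_pow,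
    ENNReal.toReal_ofReal hs0]
  simp only [ENNReal.coe_toReal, NNReal.coe_real_pi]
  ring

variable [IsProbabilityMeasure μ]

/-- In the plane the radial integrand near `0` is `y ^ (1 + r)`, whence the threshold `-2`. -/
lemma integrable_rpow_norm_sub (hμ : μ = volume.withDensity fun z => ENNReal.ofReal (p z))
    (hδ : 0 < δ) (hM0 : 0 ≤ M) (hM : ∀ x ∈ ball u δ, p x ≤ M) {r : ℝ} (hr : r ≤ 0) (hr2 : -2 < r) :
    Integrable (fun x => ‖x - u‖ ^ r) μ := by
  have := (integrable_and_integral_le_of_density_le hμ hM0 hM (h := fun y => |y| ^ r)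
    (C := δ ^ r) (by fun_prop) (fun y => by positivity) (by positivity) (fun y hy => by
      rw [abs_of_pos (hδ.trans_le hy)]
      exact Real.rpow_le_rpow_of_nonpos hδ hy hr) ?_).1
  · simpa using this
  · have h1 : IntegrableOn (fun y : ℝ => y ^ (1 + r)) (Ioo 0 δ) :=
      (intervalIntegral.integrableOn_Ioo_rpow_iff hδ).2 (by linarith)
    refine h1.congr_fun (fun y hy => ?_) measurableSet_Ioo
    simp only
    rw [abs_of_pos hy.1, Real.rpow_add hy.1, Real.rpow_one]

lemma integrable_inv_norm_sub (hμ : μ = volume.withDensity fun z => ENNReal.ofReal (p z))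
    (hδ : 0 < δ) (hM0 : 0 ≤ M) (hM : ∀ x ∈ ball u δ, p x ≤ M) :
    Integrable (fun x => ‖x - u‖⁻¹) μ := by
  have := integrable_rpow_norm_sub hμ hδ hM0 hM (r := -1) (by norm_num) (by norm_num)
  simpa [Real.rpow_neg_one] using this

lemma setIntegral_inv_norm_sub_le (hμ : μ = volume.withDensity fun z => ENNReal.ofReal (p z))
    (hM0 : 0 ≤ M) (hM : ∀ x ∈ ball u δ, p x ≤ M) (hs0 : 0 < s) (hs : s < δ) :
    ∫ x in {x | s ≤ ‖x - u‖}ᶜ, ‖x - u‖⁻¹ ∂μ ≤ M * (2 * Real.pi * s) := by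
  have hm : MeasurableSet {x : ℂ | s ≤ ‖x - u‖} := measurableSet_le (by fun_prop) (by fun_prop)
  have hind : ∀ y : ℝ, y ∈ Ioo 0 δ →
      (Iio s).indicator (fun _ => (1 : ℝ)) y = y * (Iio s).indicator (fun y => |y|⁻¹) y := by
    intro y hy
    by_cases h : y ∈ Iio s
    · simp only [h, indicator_of_mem]
      rw [abs_of_pos hy.1, mul_inv_cancel₀ hy.1.ne']
    · simp [h]
  have hset : Iio s ∩ Ioo 0 δ = Ioo 0 s := by
    ext y
    simp only [mem_inter_iff, mem_Iio, mem_Ioo]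
    constructor
    · rintro ⟨h1, h2, -⟩
      exact ⟨h2, h1⟩
    · rintro ⟨h1, h2⟩
      exact ⟨h2, h1, h2.trans hs⟩
  have := (integrable_and_integral_le_of_density_le hμ hM0 hM
    (h := (Iio s).indicator fun y => |y|⁻¹) (C := 0)
    ((by fun_prop : Measurable fun y : ℝ => |y|⁻¹).indicator measurableSet_Iio)
    (fun y => indicator_nonneg (fun y _ => by positivity) y) le_rfl (fun y hy => by
      rw [indicator_of_notMem]
      simpa using hs.le.trans hy) ?_).2
  · rw [← integral_indicator hm.compl]
    rw [← setIntegral_congr_fun measurableSet_Ioo hind, integral_indicator measurableSet_Iio,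
      Measure.restrict_restrict measurableSet_Iio, hset] at this
    simp only [integral_const, MeasurableSet.univ, measureReal_restrict_apply, univ_inter,
      smul_eq_mul, mul_one, add_zero, Real.volume_real_Ioo_of_le hs0.le, sub_zero] at this
    refine le_trans (le_of_eq ?_) this
    refine integral_congr_ae (ae_of_all _ fun x => ?_)
    simp [indicator]
  · refine IntegrableOn.congr_fun ?_ hind measurableSet_Ioo
    exact (integrable_const (1 : ℝ)).indicator measurableSet_Iio

lemma integrableOn_inv_norm_sub_cube (hs0 : 0 < s) :
    IntegrableOn (fun x => (‖x - u‖⁻¹) ^ 3) {x | s ≤ ‖x - u‖} μ := by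
  refine Measure.integrableOn_of_bounded (M := (s⁻¹) ^ 3) (measure_ne_top _ _)
    (by fun_prop) ?_
  filter_upwards [ae_restrict_mem (measurableSet_le (by fun_prop) (by fun_prop))] with x hx
  rw [Real.norm_of_nonneg (by positivity)]
  have : s ≤ ‖x - u‖ := hx
  gcongr

lemma setIntegral_inv_norm_sub_cube_le
    (hμ : μ = volume.withDensity fun z => ENNReal.ofReal (p z))
    (hM0 : 0 ≤ M) (hM : ∀ x ∈ ball u δ, p x ≤ M) (hs0 : 0 < s) (hs : s < δ) :
    ∫ x in {x | s ≤ ‖x - u‖}, (‖x - u‖⁻¹) ^ 3 ∂μ ≤ M * (2 * Real.pi * s⁻¹) + (δ⁻¹) ^ 3 := by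
  have hδ : 0 < δ := hs0.trans hs
  have hm : MeasurableSet {x : ℂ | s ≤ ‖x - u‖} := measurableSet_le (by fun_prop) (by fun_prop)
  have hind : ∀ y : ℝ, y ∈ Ioo 0 δ →
      (Ici s).indicator (fun y : ℝ => y ^ (-2 : ℝ)) y
        = y * (Ici s).indicator (fun y => (|y|⁻¹) ^ 3) y := by
    intro y hy
    by_cases h : y ∈ Ici s
    · simp only [h, indicator_of_mem]
      rw [abs_of_pos hy.1, Real.rpow_neg hy.1.le, Real.rpow_two]
      have := hy.1.ne'
      field_simp
    · simp [h]
  have hI : IntegrableOn (fun y : ℝ => y ^ (-2 : ℝ)) (Ici s) :=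
    (integrableOn_Ici_iff_integrableOn_Ioi).2 (integrableOn_Ioi_rpow_of_lt (by norm_num) hs0)
  have := (integrable_and_integral_le_of_density_le hμ hM0 hM
    (h := (Ici s).indicator fun y => (|y|⁻¹) ^ 3) (C := (δ⁻¹) ^ 3)
    ((by fun_prop : Measurable fun y : ℝ => (|y|⁻¹) ^ 3).indicator measurableSet_Ici)
    (fun y => indicator_nonneg (fun y _ => by positivity) y) (by positivity) (fun y hy => by
      rw [indicator_of_mem (show y ∈ Ici s from hs.le.trans hy), abs_of_pos (hδ.trans_le hy)]
      have := (hδ.trans_le hy).le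
      gcongr) ?_).2
  · rw [← integral_indicator hm]
    rw [← setIntegral_congr_fun measurableSet_Ioo hind, integral_indicator measurableSet_Ici,
      Measure.restrict_restrict measurableSet_Ici] at this
    have hle : ∫ y in Ici s ∩ Ioo 0 δ, y ^ (-2 : ℝ) ≤ s⁻¹ := by
      calc ∫ y in Ici s ∩ Ioo 0 δ, y ^ (-2 : ℝ) ≤ ∫ y in Ici s, y ^ (-2 : ℝ) := by
            refine setIntegral_mono_set hI ?_ (Eventually.of_forall fun y hy => hy.1)
            filter_upwards [ae_restrict_mem measurableSet_Ici] with y hy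
            exact Real.rpow_nonneg (hs0.le.trans hy) _
        _ = s⁻¹ := by
            rw [integral_Ici_eq_integral_Ioi, integral_Ioi_rpow_of_lt (by norm_num) hs0]
            norm_num [Real.rpow_neg_one]
    calc _ = ∫ x, (Ici s).indicator (fun y => (|y|⁻¹) ^ 3) ‖x - u‖ ∂μ := by
          refine integral_congr_ae (ae_of_all _ fun x => ?_)
          simp [indicator]
      _ ≤ _ := this
      _ ≤ _ := by gcongr
  · refine IntegrableOn.congr_fun ?_ hind measurableSet_Ioo
    exact (hI.integrable_indicator measurableSet_Ici).integrableOn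

end CauchyKernelMoments

/-! ### Central limit theorem for `1/(u - ξ)` -/

section HeavyTailedCLT

open Metric Set
open scoped RealInnerProductSpace

/-- If `ζ` has a density that is continuous and positive at `u`, then `1 / (u - ζ)` lies in the non-standard domain of
attraction of a complex normal law, with normalization `√(n log n)`. -/
lemma tendsto_integral_exp_inner_inv_sub_pow {p : ℂ → ℝ} (hp0 : ∀ z, 0 ≤ p z) (hpm : Measurable p)
    {μ : Measure ℂ} [IsProbabilityMeasure μ]
    (hμ : μ = volume.withDensity fun z => ENNReal.ofReal (p z)) {u : ℂ} (hu : ContinuousAt p u)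
    (hpu : 0 < p u) (t : ℂ) :
    Tendsto (fun n : ℕ => (∫ x, Complex.exp
        ((⟪(u - x)⁻¹ - ∫ y, (u - y)⁻¹ ∂μ, t⟫ / (√(Real.pi * p u) * √(n * Real.log n)) : ℝ)
          * Complex.I) ∂μ) ^ n) atTop
      (𝓝 (Complex.exp (-(‖t‖ ^ 2 / 4 : ℝ)))) := by
  obtain ⟨δ, hδ, M, hM0, hM⟩ := exists_density_le_of_continuousAt hp0 hu
  set c := Real.pi * p u with hc
  have hc0 : 0 < c := by positivity
  set f := ∫ y, (u - y)⁻¹ ∂μ with hf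
  set X : ℂ → ℝ := fun x => ⟪(u - x)⁻¹ - f, t⟫ with hX
  set g : ℂ → ℝ := fun x => ⟪(u - x)⁻¹, t⟫ with hg
  -- At this cutoff `log (1 / s n) = (log n) / 2`, and the third moment outside the disk and the
  -- first moment inside it are both negligible by a power of `log n`.
  set s : ℕ → ℝ := fun n => (√(n : ℝ))⁻¹ with hs
  set A : ℕ → Set ℂ := fun n => {x | s n ≤ ‖x - u‖} with hA
  have hmA : ∀ n, MeasurableSet (A n) := fun n => measurableSet_le (by fun_prop) (by fun_prop)
  have hIinv := integrable_inv_norm_sub hμ hδ hM0 hM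
  have hIZ : Integrable (fun x => (u - x)⁻¹) μ := by
    refine hIinv.mono' (by fun_prop) (ae_of_all _ fun x => ?_)
    rw [norm_inv, norm_sub_rev]
  have hXm : Measurable X := by fun_prop
  have hIg : Integrable g μ := hIZ.inner_const t
  have hIX : Integrable X μ := (hIZ.sub (integrable_const f)).inner_const t
  have hXg : ∀ x, X x = g x - ⟪f, t⟫ := fun x => inner_sub_left _ _ _
  have hX0 : ∫ x, X x ∂μ = 0 := by
    have h1 : ∫ x, g x ∂μ = ⟪f, t⟫ := by
      have := integral_inner (𝕜 := ℝ) hIZ t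
      rw [hf, real_inner_comm, ← this]
      exact integral_congr_ae (ae_of_all _ fun x => real_inner_comm _ _)
    simp_rw [hXg]
    rw [integral_sub hIg (integrable_const _), h1]
    simp
  have hXle : ∀ x, |X x| ≤ ‖t‖ * (‖x - u‖⁻¹ + ‖f‖) := by
    intro x
    refine (abs_real_inner_le_norm _ _).trans ?_
    rw [mul_comm]
    gcongr
    refine (norm_sub_le _ _).trans ?_
    rw [norm_inv, norm_sub_rev]
  have hXle3 : ∀ x, |X x| ^ 3 ≤ 4 * ‖t‖ ^ 3 * ((‖x - u‖⁻¹) ^ 3 + ‖f‖ ^ 3) := by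
    intro x
    have h1 : |X x| ^ 3 ≤ (‖t‖ * (‖x - u‖⁻¹ + ‖f‖)) ^ 3 := by
      gcongr
      exact hXle x
    refine h1.trans ?_
    rw [mul_pow]
    have := add_pow_le (a := ‖x - u‖⁻¹) (b := ‖f‖) (by positivity) (by positivity) 3
    have ht : 0 ≤ ‖t‖ ^ 3 := by positivity
    nlinarith
  have hev : ∀ᶠ n : ℕ in atTop, 1 < n ∧ 0 < s n ∧ s n < δ := by
    have h1 : Tendsto s atTop (𝓝 0) := tendsto_inv_atTop_zero.comp
      (Real.tendsto_sqrt_atTop.comp tendsto_natCast_atTop_atTop)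
    filter_upwards [eventually_gt_atTop 1, h1.eventually_lt_const hδ] with n hn hn'
    refine ⟨hn, ?_, hn'⟩
    have : (0 : ℝ) < n := by exact_mod_cast (zero_lt_one.trans hn)
    positivity
  set l : ℕ → ℝ := fun n => √c * √(Real.log n) with hl
  have hlt : Tendsto l atTop atTop :=
    Tendsto.const_mul_atTop (by positivity) (Real.tendsto_sqrt_atTop.comp
      (Real.tendsto_log_atTop.comp tendsto_natCast_atTop_atTop))
  have ha_eq : ∀ n : ℕ, √c * √(n * Real.log n) = √(n : ℝ) * l n := by
    intro n
    rw [Real.sqrt_mul n.cast_nonneg]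
    simp only [hl]
    ring
  have ha : ∀ᶠ n : ℕ in atTop, 0 < √c * √(n * Real.log n) := by
    filter_upwards [hev, hlt.eventually_gt_atTop 0] with n hn hln
    rw [ha_eq]
    have : (0 : ℝ) < n := by exact_mod_cast (zero_lt_one.trans hn.1)
    positivity
  have hI3 : ∀ᶠ n in atTop, IntegrableOn (fun x => |X x| ^ 3) (A n) μ := by
    filter_upwards [hev] with n hn
    refine (((integrableOn_inv_norm_sub_cube hn.2.1).add (integrable_const (‖f‖ ^ 3))).const_mul
      (4 * ‖t‖ ^ 3)).mono'
      (by fun_prop) (ae_of_all _ fun x => ?_)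
    rw [Real.norm_of_nonneg (by positivity)]
    exact hXle3 x
  have hsq := tendsto_truncated_second_moment hp0 hpm hμ hu t
  have hs0 : Tendsto s atTop (𝓝[>] 0) := by
    refine tendsto_nhdsWithin_iff.2 ⟨tendsto_inv_atTop_zero.comp
      (Real.tendsto_sqrt_atTop.comp tendsto_natCast_atTop_atTop), ?_⟩
    filter_upwards [hev] with n hn using hn.2.1
  -- Centring changes the truncated second moment by a bounded amount only, which disappears at
  -- scale `log n`. The limit is `‖t‖ ^ 2 / 2` because the cutoff contributes half a logarithm.
  have h2 : Tendsto (fun n : ℕ => n / (√c * √(n * Real.log n)) ^ 2 * ∫ x in A n, X x ^ 2 ∂μ) atTop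
      (𝓝 (‖t‖ ^ 2 / 2)) := by
    have h21 := ((hsq.comp hs0).div_const (2 * c))
    have hK : Tendsto (fun n : ℕ => (2 * |⟪f, t⟫| * (∫ x, |g x| ∂μ) + ⟪f, t⟫ ^ 2) / l n ^ 2) atTop
        (𝓝 0) :=
      Tendsto.const_div_atTop ((tendsto_pow_atTop two_ne_zero).comp hlt) _
    have hdiff : Tendsto (fun n : ℕ => n / (√c * √(n * Real.log n)) ^ 2 * ∫ x in A n, X x ^ 2 ∂μ
        - n / (√c * √(n * Real.log n)) ^ 2 * ∫ x in A n, g x ^ 2 ∂μ) atTop (𝓝 0) := by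
      refine squeeze_zero_norm' ?_ hK
      filter_upwards [hev, hlt.eventually_gt_atTop 0] with n hn hln
      have hn0 : (0 : ℝ) < n := by exact_mod_cast (zero_lt_one.trans hn.1)
      have hIg2 : IntegrableOn (fun x => g x ^ 2) (A n) μ := by
        refine Measure.integrableOn_of_bounded (M := ‖t‖ ^ 2 * ((s n)⁻¹) ^ 2) (measure_ne_top _ _)
          (by fun_prop) ?_
        filter_upwards [ae_restrict_mem (hmA n)] with x hx
        rw [Real.norm_of_nonneg (sq_nonneg _)]
        refine (norm_inner_sq_le _ _).trans ?_
        rw [norm_inv, norm_sub_rev]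
        have h' : s n ≤ ‖x - u‖ := hx
        have := hn.2.1
        gcongr
      have e : ∫ x in A n, X x ^ 2 ∂μ = ∫ x in A n, g x ^ 2 ∂μ
          + ∫ x in A n, (⟪f, t⟫ ^ 2 - 2 * ⟪f, t⟫ * g x) ∂μ := by
        have hIl : IntegrableOn (fun x => ⟪f, t⟫ ^ 2 - 2 * ⟪f, t⟫ * g x) (A n) μ :=
          (integrable_const _).sub (hIg.integrableOn.const_mul _)
        rw [← integral_add hIg2 hIl]
        refine integral_congr_ae (ae_of_all _ fun x => ?_)
        simp only [hXg]
        ring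
      rw [← mul_sub, e, add_sub_cancel_left, ha_eq, mul_pow, Real.sq_sqrt hn0.le, norm_mul,
        Real.norm_of_nonneg (by positivity), div_mul_eq_mul_div, div_le_div_iff₀ (by positivity)
          (by positivity)]
      have hb : ‖∫ x in A n, (⟪f, t⟫ ^ 2 - 2 * ⟪f, t⟫ * g x) ∂μ‖
          ≤ 2 * |⟪f, t⟫| * (∫ x, |g x| ∂μ) + ⟪f, t⟫ ^ 2 := by
        have hI : Integrable (fun x => 2 * |⟪f, t⟫| * |g x| + ⟪f, t⟫ ^ 2) μ :=
          (hIg.abs.const_mul _).add (integrable_const _)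
        calc _ ≤ ∫ x in A n, (2 * |⟪f, t⟫| * |g x| + ⟪f, t⟫ ^ 2) ∂μ := by
              refine norm_integral_le_of_norm_le hI.integrableOn (ae_of_all _ fun x => ?_)
              refine (norm_sub_le _ _).trans ?_
              rw [Real.norm_of_nonneg (sq_nonneg _), Real.norm_eq_abs, abs_mul, abs_mul, abs_two]
              linarith
          _ ≤ ∫ x, (2 * |⟪f, t⟫| * |g x| + ⟪f, t⟫ ^ 2) ∂μ :=
              setIntegral_le_integral hI (ae_of_all _ fun x => by positivity)
          _ = _ := by
              rw [integral_add (hIg.abs.const_mul _) (integrable_const _), integral_const_mul]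
              simp
      calc _ = ‖∫ x in A n, (⟪f, t⟫ ^ 2 - 2 * ⟪f, t⟫ * g x) ∂μ‖ * (n * l n ^ 2) := by ring
        _ ≤ _ := by gcongr
    have h22 : Tendsto (fun n : ℕ => n / (√c * √(n * Real.log n)) ^ 2 * ∫ x in A n, g x ^ 2 ∂μ)
        atTop (𝓝 (‖t‖ ^ 2 / 2)) := by
      have : Real.pi * p u * ‖t‖ ^ 2 / (2 * c) = ‖t‖ ^ 2 / 2 := by
        rw [hc] at hc0 ⊢
        field_simp
      rw [this] at h21
      refine h21.congr' ?_
      filter_upwards [hev] with n hn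
      have hn0 : (0 : ℝ) < n := by exact_mod_cast (zero_lt_one.trans hn.1)
      have hlog : 0 < Real.log n := Real.log_pos (by exact_mod_cast hn.1)
      simp only [Function.comp, hs, inv_inv]
      rw [mul_pow, Real.sq_sqrt hc0.le, Real.sq_sqrt (by positivity), Real.log_sqrt hn0.le]
      change (∫ x in A n, g x ^ 2 ∂μ) / (Real.log n / 2) / (2 * c) = _
      field_simp
    have := hdiff.add h22
    simpa using this
  -- The truncated third moment is `O(1 / s n) = O(√n)`, which leaves a bound of order `(log n) ^
  -- (-3/2)`.
  have h3 : Tendsto (fun n : ℕ => n / (√c * √(n * Real.log n)) ^ 3 * ∫ x in A n, |X x| ^ 3 ∂μ) atTop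
      (𝓝 0) := by
    set K := 4 * ‖t‖ ^ 3 * (M * (2 * Real.pi) + (δ⁻¹) ^ 3 + ‖f‖ ^ 3) with hKdef
    have hK : Tendsto (fun n : ℕ => K / l n ^ 3) atTop (𝓝 0) :=
      Tendsto.const_div_atTop ((tendsto_pow_atTop three_ne_zero).comp hlt) _
    refine squeeze_zero' ?_ ?_ hK
    · filter_upwards [ha] with n hn
      have := hn.le
      have : 0 ≤ ∫ x in A n, |X x| ^ 3 ∂μ := integral_nonneg fun x => by positivity
      positivity
    · filter_upwards [hev, hlt.eventually_gt_atTop 0] with n hn hln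
      have hn0 : (0 : ℝ) < n := by exact_mod_cast (zero_lt_one.trans hn.1)
      have hn1 : 1 ≤ √(n : ℝ) := Real.one_le_sqrt.2 (by exact_mod_cast hn.1.le)
      have hb : ∫ x in A n, |X x| ^ 3 ∂μ ≤ K * √(n : ℝ) := by
        have hI : IntegrableOn (fun x => (‖x - u‖⁻¹) ^ 3) (A n) μ :=
          integrableOn_inv_norm_sub_cube hn.2.1
        have hm := setIntegral_inv_norm_sub_cube_le hμ hM0 hM hn.2.1 hn.2.2
        calc ∫ x in A n, |X x| ^ 3 ∂μ
            ≤ ∫ x in A n, 4 * ‖t‖ ^ 3 * ((‖x - u‖⁻¹) ^ 3 + ‖f‖ ^ 3) ∂μ := by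
              refine integral_mono_of_nonneg (ae_of_all _ fun x => by positivity)
                ((hI.add (integrable_const _)).const_mul _) (ae_of_all _ hXle3)
          _ = 4 * ‖t‖ ^ 3 * ((∫ x in A n, (‖x - u‖⁻¹) ^ 3 ∂μ) + μ.real (A n) * ‖f‖ ^ 3) := by
              rw [integral_const_mul, integral_add hI (integrable_const _)]
              simp
          _ ≤ 4 * ‖t‖ ^ 3 * ((M * (2 * Real.pi * (s n)⁻¹) + (δ⁻¹) ^ 3) + 1 * ‖f‖ ^ 3) := by
              gcongr
              exact measureReal_le_one
          _ = 4 * ‖t‖ ^ 3 * (M * (2 * Real.pi) * √(n : ℝ) + ((δ⁻¹) ^ 3 + ‖f‖ ^ 3) * 1) := by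
              simp only [hs, inv_inv]
              ring
          _ ≤ 4 * ‖t‖ ^ 3 * (M * (2 * Real.pi) * √(n : ℝ) + ((δ⁻¹) ^ 3 + ‖f‖ ^ 3) * √(n : ℝ)) := by
              gcongr
          _ = K * √(n : ℝ) := by rw [hKdef]; ring
      rw [ha_eq]
      calc _ ≤ n / (√(n : ℝ) * l n) ^ 3 * (K * √(n : ℝ)) := by gcongr
        _ = K * (n * √(n : ℝ)) / (√(n : ℝ) ^ 3 * l n ^ 3) := by ring
        _ = K * (n * √(n : ℝ)) / (n * √(n : ℝ) * l n ^ 3) := by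
            rw [pow_succ (√(n : ℝ)), Real.sq_sqrt hn0.le]
        _ ≤ K / l n ^ 3 := by
            rw [mul_comm K, mul_div_mul_left]
            positivity
  -- The first moment inside the disk is `O(s n)`, which leaves a bound of order `(log n) ^ (-1/2)`.
  have h1 : Tendsto (fun n : ℕ => n / (√c * √(n * Real.log n)) * ∫ x in (A n)ᶜ, |X x| ∂μ) atTop
      (𝓝 0) := by
    set K := ‖t‖ * (M * (2 * Real.pi) + M * Real.pi * ‖f‖) with hKdef
    have hK : Tendsto (fun n : ℕ => K / l n) atTop (𝓝 0) := Tendsto.const_div_atTop hlt _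
    refine squeeze_zero' ?_ ?_ hK
    · filter_upwards [ha] with n hn
      have : 0 ≤ ∫ x in (A n)ᶜ, |X x| ∂μ := integral_nonneg fun x => by positivity
      positivity
    · filter_upwards [hev, hlt.eventually_gt_atTop 0] with n hn hln
      have hn0 : (0 : ℝ) < n := by exact_mod_cast (zero_lt_one.trans hn.1)
      have hn1 : 1 ≤ √(n : ℝ) := Real.one_le_sqrt.2 (by exact_mod_cast hn.1.le)
      have hs1 : s n ≤ 1 := inv_le_one_of_one_le₀ hn1
      have hsp := hn.2.1
      have hmA' : μ.real (A n)ᶜ ≤ M * (Real.pi * s n ^ 2) := by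
        refine le_trans (measureReal_mono ?_)
          (measureReal_closedBall_le hμ hM0 hM hsp.le hn.2.2)
        intro x hx
        have : ‖x - u‖ < s n := by simpa [hA] using hx
        simpa [dist_eq_norm] using this.le
      have hb : ∫ x in (A n)ᶜ, |X x| ∂μ ≤ K * s n := by
        have hm := setIntegral_inv_norm_sub_le hμ hM0 hM hsp hn.2.2
        calc ∫ x in (A n)ᶜ, |X x| ∂μ ≤ ∫ x in (A n)ᶜ, ‖t‖ * (‖x - u‖⁻¹ + ‖f‖) ∂μ :=
              integral_mono_of_nonneg (ae_of_all _ fun x => by positivity)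
                ((hIinv.integrableOn.add (integrable_const _)).const_mul _) (ae_of_all _ hXle)
          _ = ‖t‖ * ((∫ x in (A n)ᶜ, ‖x - u‖⁻¹ ∂μ) + μ.real (A n)ᶜ * ‖f‖) := by
              rw [integral_const_mul, integral_add hIinv.integrableOn (integrable_const _)]
              simp
          _ ≤ ‖t‖ * (M * (2 * Real.pi * s n) + M * (Real.pi * (s n * 1)) * ‖f‖) := by
              gcongr
              refine hmA'.trans ?_
              rw [sq]
              gcongr
          _ = K * s n := by rw [hKdef]; ring
      rw [ha_eq]
      calc _ ≤ n / (√(n : ℝ) * l n) * (K * s n) := by gcongr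
        _ = n * K / (√(n : ℝ) ^ 2 * l n) := by
            simp only [hs]
            field_simp
        _ = K / l n := by
            rw [Real.sq_sqrt hn0.le, mul_div_mul_left _ _ hn0.ne']
  have := tendsto_integral_exp_pow_of_truncation hXm hIX hX0 hmA ha hI3 h2 h3 h1
  have e4 : ‖t‖ ^ 2 / 2 / 2 = ‖t‖ ^ 2 / 4 := by ring
  rwa [e4] at this

end HeavyTailedCLT

/-! ### Critical points as fixed points of a contraction (deterministic) -/

section CriticalPoints

open Metric Set Polynomial

/-- The derivative is `∏_{k≥1} (ζ - a_k)` times `1 + (ζ - a_0) ∑ 1/(ζ - a_k)`, and separation keeps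
the product away from zero. The product is not divided by `ζ - a 0`, so `ζ = a 0` needs no separate
case. -/
lemma isCriticalPointNear_iff {a : ℕ → ℂ} {n : ℕ} {r : ℝ} (hr : 0 < r)
    (hsep : ∀ k < n, 2 * r < ‖a 0 - a (k + 1)‖) (ζ : ℂ) :
    IsCriticalPointNear a n r ζ ↔ ‖ζ - a 0‖ ≤ r ∧
      (ζ - a 0) * ∑ k ∈ Finset.range n, (ζ - a (k + 1))⁻¹ = -1 := by
  rw [IsCriticalPointNear, mem_closedBall, dist_eq_norm]
  refine and_congr_right fun hζ => ?_
  have hne : ∀ k ∈ Finset.range n, ζ - a (k + 1) ≠ 0 := by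
    intro k hk h0
    have h1 := hsep k (Finset.mem_range.1 hk)
    rw [sub_eq_zero] at h0
    rw [← h0, norm_sub_rev] at h1
    linarith
  have hprod : ∏ k ∈ Finset.range n, (ζ - a (k + 1)) ≠ 0 := Finset.prod_ne_zero_iff.2 hne
  have hderiv : (polyOfZeros a n).derivative.eval ζ = (∏ k ∈ Finset.range n, (ζ - a (k + 1))) *
      (1 + (ζ - a 0) * ∑ k ∈ Finset.range n, (ζ - a (k + 1))⁻¹) := by
    rw [polyOfZeros, Finset.prod_range_succ', derivative_mul, derivative_prod_finset]
    simp only [derivative_X_sub_C, mul_one, eval_add, eval_mul, eval_finsetSum, eval_prod,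
      eval_sub, eval_X, eval_C]
    have : ∀ k ∈ Finset.range n, ∏ j ∈ (Finset.range n).erase k, (ζ - a (j + 1))
        = (∏ j ∈ Finset.range n, (ζ - a (j + 1))) * (ζ - a (k + 1))⁻¹ := by
      intro k hk
      rw [← Finset.mul_prod_erase _ _ hk, mul_comm, inv_mul_cancel_left₀ (hne k hk)]
    rw [Finset.sum_congr rfl this, ← Finset.mul_sum]
    ring
  rw [hderiv, mul_eq_zero, or_iff_right hprod, add_comm, add_eq_zero_iff_eq_neg]

lemma norm_sum_inv_sub_sum_inv_le {ι : Type*} (s : Finset ι) (b : ι → ℂ) {u z z' : ℂ} {r : ℝ}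
    (hsep : ∀ k ∈ s, 2 * r < ‖u - b k‖) (hz : ‖z - u‖ ≤ r) (hz' : ‖z' - u‖ ≤ r) :
    ‖∑ k ∈ s, (z - b k)⁻¹ - ∑ k ∈ s, (z' - b k)⁻¹‖
      ≤ 4 * (∑ k ∈ s, (‖u - b k‖⁻¹) ^ 2) * ‖z - z'‖ := by
  rw [← Finset.sum_sub_distrib, Finset.mul_sum, Finset.sum_mul]
  refine norm_sum_le_of_le _ fun k hk => ?_
  have hr : 0 ≤ r := (norm_nonneg _).trans hz
  have hpos : 0 < ‖u - b k‖ := (by positivity : 0 ≤ 2 * r).trans_lt (hsep k hk)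
  -- Moving by at most `r` from `u` loses at most half of a distance exceeding `2 r`; the two halves
  -- produce the constant `4`.
  have hlow : ∀ y : ℂ, ‖y - u‖ ≤ r → ‖u - b k‖ / 2 ≤ ‖y - b k‖ := by
    intro y hy
    have h1 := norm_sub_le_norm_add (u - b k) (y - u)
    have h2 : u - b k + (y - u) = y - b k := by ring
    rw [h2] at h1
    linarith [hsep k hk]
  have h1 := hlow z hz
  have h2 := hlow z' hz'
  have hz0 : z - b k ≠ 0 := norm_pos_iff.1 (by linarith)
  have hz0' : z' - b k ≠ 0 := norm_pos_iff.1 (by linarith)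
  rw [inv_sub_inv hz0 hz0', norm_div, norm_mul]
  have e : z' - b k - (z - b k) = z' - z := by ring
  rw [e, norm_sub_rev z' z]
  calc ‖z - z'‖ / (‖z - b k‖ * ‖z' - b k‖) ≤ ‖z - z'‖ / (‖u - b k‖ / 2 * (‖u - b k‖ / 2)) := by
        gcongr
    _ = _ := by
        field_simp
        norm_num

section

variable {a : ℕ → ℂ} {n : ℕ} {r ε : ℝ} {F : ℂ} {z : ℂ}

lemma norm_sum_inv_sub_le (hr : 0 < r) (hsep : ∀ k < n, 2 * r < ‖a 0 - a (k + 1)‖)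
    (hS : ‖∑ k ∈ Finset.range n, (a 0 - a (k + 1))⁻¹ - F‖ ≤ ε * ‖F‖)
    (hV : 16 * (r * ∑ k ∈ Finset.range n, (‖a 0 - a (k + 1)‖⁻¹) ^ 2) ≤ ε * ‖F‖)
    (hz : ‖z - a 0‖ ≤ r) :
    ‖∑ k ∈ Finset.range n, (z - a (k + 1))⁻¹ - F‖ ≤ 2 * ε * ‖F‖ := by
  have h1 := norm_sum_inv_sub_sum_inv_le (Finset.range n) (fun k => a (k + 1)) (u := a 0) (z := z)
    (z' := a 0) (fun k hk => hsep k (Finset.mem_range.1 hk)) hz (by simpa using hr.le)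
  set V := ∑ k ∈ Finset.range n, (‖a 0 - a (k + 1)‖⁻¹) ^ 2
  have hV0 : 0 ≤ V := Finset.sum_nonneg fun k _ => by positivity
  have h2 : 4 * V * ‖z - a 0‖ ≤ 4 * V * r := by gcongr
  have h3 := norm_sub_le_norm_sub_add_norm_sub (∑ k ∈ Finset.range n, (z - a (k + 1))⁻¹)
    (∑ k ∈ Finset.range n, (a 0 - a (k + 1))⁻¹) F
  nlinarith [mul_nonneg hr.le hV0]

/-- Banach's fixed point theorem for `T z = a 0 - 1 / S z`: `|S| ≥ ‖F‖ / 2` and `r ‖F‖ ≥ 2` keep `T`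
inside the disk, while smallness of `V` relative to `‖F‖ ^ 2` makes `T` a `1/2`-contraction. -/
lemma existsUnique_isCriticalPointNear (hr : 0 < r) (hsep : ∀ k < n, 2 * r < ‖a 0 - a (k + 1)‖)
    (hε : ε ≤ 1 / 4)
    (hS : ‖∑ k ∈ Finset.range n, (a 0 - a (k + 1))⁻¹ - F‖ ≤ ε * ‖F‖)
    (hV : 16 * (r * ∑ k ∈ Finset.range n, (‖a 0 - a (k + 1)‖⁻¹) ^ 2) ≤ ε * ‖F‖)
    (hF : 2 ≤ r * ‖F‖) :
    ∃! ζ, IsCriticalPointNear a n r ζ := by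
  set S : ℂ → ℂ := fun z => ∑ k ∈ Finset.range n, (z - a (k + 1))⁻¹ with hSdef
  set V := ∑ k ∈ Finset.range n, (‖a 0 - a (k + 1)‖⁻¹) ^ 2 with hVdef
  have hV0 : 0 ≤ V := Finset.sum_nonneg fun k _ => by positivity
  have hF0 : 0 < ‖F‖ := by
    by_contra h
    have : ‖F‖ = 0 := le_antisymm (not_lt.1 h) (norm_nonneg _)
    rw [this] at hF
    linarith
  have hlow : ∀ z, ‖z - a 0‖ ≤ r → ‖F‖ / 2 ≤ ‖S z‖ := by
    intro z hz
    have h1 := norm_sum_inv_sub_le hr hsep hS hV hz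
    have h2 := norm_sub_norm_le F (S z)
    rw [norm_sub_rev] at h2
    nlinarith
  -- Multiplying by `r * ‖F‖ ≥ 2` trades the factor `r` in the bound on `V` for a second factor
  -- `‖F‖`.
  have hVF : 16 * V ≤ ‖F‖ ^ 2 / 2 := by
    have h1 : 16 * (r * V) ≤ 1 / 4 * ‖F‖ := hV.trans (by gcongr)
    have h2 : 2 * (16 * V) ≤ r * ‖F‖ * (16 * V) := by gcongr
    nlinarith
  set T : ℂ → ℂ := fun z => a 0 - (S z)⁻¹ with hT
  have hlip : ∀ z z', ‖z - a 0‖ ≤ r → ‖z' - a 0‖ ≤ r → ‖T z - T z'‖ ≤ 1 / 2 * ‖z - z'‖ := by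
    intro z z' hz hz'
    have h1 := norm_sum_inv_sub_sum_inv_le (Finset.range n) (fun k => a (k + 1)) (u := a 0) (z := z)
      (z' := z') (fun k hk => hsep k (Finset.mem_range.1 hk)) hz hz'
    have hz0 : S z ≠ 0 := norm_pos_iff.1 (by linarith [hlow z hz])
    have hz0' : S z' ≠ 0 := norm_pos_iff.1 (by linarith [hlow z' hz'])
    have e : T z - T z' = (S z - S z') / (S z * S z') := by
      simp only [hT]
      field_simp
      ring
    rw [e, norm_div, norm_mul, div_le_iff₀ (by positivity)]
    calc ‖S z - S z'‖ ≤ 4 * V * ‖z - z'‖ := h1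
      _ ≤ 1 / 2 * ‖z - z'‖ * (‖F‖ / 2 * (‖F‖ / 2)) := by nlinarith [norm_nonneg (z - z')]
      _ ≤ _ := by
        have := hlow z hz
        have := hlow z' hz'
        gcongr
  have hmaps : MapsTo T (closedBall (a 0) r) (closedBall (a 0) r) := by
    intro z hz
    rw [mem_closedBall, dist_eq_norm] at hz ⊢
    simp only [hT, sub_sub_cancel_left, norm_neg, norm_inv]
    refine inv_le_of_inv_le₀ hr (le_trans ?_ (hlow z hz))
    rw [inv_le_iff_one_le_mul₀ hr]
    linarith
  have hfix : ∀ z, ‖z - a 0‖ ≤ r → (T z = z ↔ (z - a 0) * S z = -1) := by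
    intro z hz
    have hz0 : S z ≠ 0 := norm_pos_iff.1 (by linarith [hlow z hz])
    rw [← sub_left_inj (a := a 0), eq_comm]
    simp only [hT, sub_sub_cancel_left]
    rw [show -(S z)⁻¹ = -1 / S z by ring, eq_div_iff hz0]
  have hcontr : ContractingWith (1 / 2) (hmaps.restrict T _ _) := by
    refine ⟨by norm_num, LipschitzWith.of_dist_le_mul fun x y => ?_⟩
    have hx := x.2
    have hy := y.2
    rw [mem_closedBall, dist_eq_norm] at hx hy
    simpa [Subtype.dist_eq, dist_eq_norm] using hlip x y hx hy
  obtain ⟨ζ, hζ, hζfix, -⟩ := hcontr.exists_fixedPoint' isClosed_closedBall.isComplete hmaps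
    (mem_closedBall_self hr.le) (edist_ne_top _ _)
  rw [mem_closedBall, dist_eq_norm] at hζ
  refine ⟨ζ, (isCriticalPointNear_iff hr hsep ζ).2 ⟨hζ, (hfix ζ hζ).1 hζfix⟩, fun y hy => ?_⟩
  obtain ⟨hy1, hy2⟩ := (isCriticalPointNear_iff hr hsep y).1 hy
  have hyfix := (hfix y hy1).2 hy2
  have h := hlip y ζ hy1 hζ
  rw [hyfix, hζfix.eq] at h
  have : ‖y - ζ‖ = 0 := by linarith [norm_nonneg (y - ζ)]
  exact sub_eq_zero.1 (norm_eq_zero.1 this)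

end

end CriticalPoints

/-! ### Typical configurations have probability tending to one -/

section TypicalConfigurations

open Metric Set

/-- The zeros `b 0, …, b (n - 1)` are in typical position relative to `u`: none of them is within
distance `2 r` of `u`, `∑ 1 / (u - b k)` is close to `n f(u)`, and `∑ 1 / |u - b k| ^ 2` is at most
`n ^ (5 / 4)`. The remaining conditions say that `n` is large depending on `u`. -/
structure IsTypical (p : ℂ → ℝ) (f : ℂ → ℂ) (r : ℕ → ℝ) (ε : ℝ) (n : ℕ) (u : ℂ) (b : ℕ → ℂ) :
    Prop where
  separated : ∀ k < n, 2 * r n < ‖u - b k‖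
  sum_close : ‖∑ k ∈ Finset.range n, (u - b k)⁻¹ - n * f u‖ ≤ ε * ‖n * f u‖
  sum_sq_le : ∑ k ∈ Finset.range n, (‖u - b k‖⁻¹) ^ 2 ≤ (n : ℝ) ^ (5 / 4 : ℝ)
  radius_le : 16 * (r n * (n : ℝ) ^ (5 / 4 : ℝ)) ≤ ε * ‖n * f u‖
  le_radius : 2 ≤ r n * ‖n * f u‖
  error_le : 8 * (n : ℝ) ^ (5 / 4 : ℝ) ≤
    ε * (√(Real.pi * p u) * √(n * Real.log n)) * ‖n * f u‖
  one_lt : 1 < n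

lemma measurableSet_isTypical {p : ℂ → ℝ} (hp : Measurable p) {f : ℂ → ℂ} (hf : Measurable f)
    (r : ℕ → ℝ) (ε : ℝ) (n : ℕ) :
    MeasurableSet {x : ℂ × (ℕ → ℂ) | IsTypical p f r ε n x.1 x.2} := by
  have hsum : Measurable fun x : ℂ × (ℕ → ℂ) => ∑ k ∈ Finset.range n, (x.1 - x.2 k)⁻¹ :=
    Finset.measurable_fun_sum _ fun k _ => by fun_prop
  have hsum2 : Measurable fun x : ℂ × (ℕ → ℂ) => ∑ k ∈ Finset.range n, (‖x.1 - x.2 k‖⁻¹) ^ 2 :=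
    Finset.measurable_fun_sum _ fun k _ => by fun_prop
  have h1 : MeasurableSet {x : ℂ × (ℕ → ℂ) | ∀ k < n, 2 * r n < ‖x.1 - x.2 k‖} := by
    simp only [ofPred_forall]
    exact MeasurableSet.iInter fun k => MeasurableSet.iInter fun _ =>
      measurableSet_lt (by fun_prop) (by fun_prop)
  have h2 : MeasurableSet {x : ℂ × (ℕ → ℂ) |
      ‖∑ k ∈ Finset.range n, (x.1 - x.2 k)⁻¹ - n * f x.1‖ ≤ ε * ‖n * f x.1‖} :=
    measurableSet_le (by fun_prop) (by fun_prop)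
  have h3 : MeasurableSet {x : ℂ × (ℕ → ℂ) |
      ∑ k ∈ Finset.range n, (‖x.1 - x.2 k‖⁻¹) ^ 2 ≤ (n : ℝ) ^ (5 / 4 : ℝ)} :=
    measurableSet_le (by fun_prop) (by fun_prop)
  have h4 : MeasurableSet {x : ℂ × (ℕ → ℂ) |
      16 * (r n * (n : ℝ) ^ (5 / 4 : ℝ)) ≤ ε * ‖n * f x.1‖} :=
    measurableSet_le (by fun_prop) (by fun_prop)
  have h5 : MeasurableSet {x : ℂ × (ℕ → ℂ) | 2 ≤ r n * ‖n * f x.1‖} :=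
    measurableSet_le (by fun_prop) (by fun_prop)
  have h6 : MeasurableSet {x : ℂ × (ℕ → ℂ) | 8 * (n : ℝ) ^ (5 / 4 : ℝ) ≤
      ε * (√(Real.pi * p x.1) * √(n * Real.log n)) * ‖n * f x.1‖} :=
    measurableSet_le (by fun_prop) (by fun_prop)
  have h7 : MeasurableSet {_x : ℂ × (ℕ → ℂ) | 1 < n} := MeasurableSet.const _
  convert! ((((((h1.inter h2).inter h3).inter h4).inter h5).inter h6).inter h7) using 1
  ext x
  exact ⟨fun h => ⟨⟨⟨⟨⟨⟨h.1, h.2⟩, h.3⟩, h.4⟩, h.5⟩, h.6⟩, h.7⟩,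
    fun ⟨⟨⟨⟨⟨⟨h1, h2⟩, h3⟩, h4⟩, h5⟩, h6⟩, h7⟩ => ⟨h1, h2, h3, h4, h5, h6, h7⟩⟩

lemma sum_rpow_le_sum_rpow {ι : Type*} (s : Finset ι) {g : ι → ℝ} (hg : ∀ i ∈ s, 0 ≤ g i) {q : ℝ}
    (hq0 : 0 < q) (hq1 : q ≤ 1) : (∑ i ∈ s, g i) ^ q ≤ ∑ i ∈ s, g i ^ q :=
  Finset.le_sum_of_subadditive_on_pred (fun x : ℝ => x ^ q) (fun x => 0 ≤ x)
    (by simp [hq0.ne']) (fun x y hx hy => 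
      NNReal.coe_le_coe.2 (NNReal.rpow_add_le_add_rpow ⟨x, hx⟩ ⟨y, hy⟩ hq0.le hq1))
    (fun x y hx hy => add_nonneg hx hy) g hg

variable {Ω : Type*} [MeasurableSpace Ω] {P : Measure Ω} {η : ℕ → Ω → ℂ} {μ : Measure ℂ} {p : ℂ → ℝ} {u : ℂ} {r : ℕ → ℝ}

/-- A union bound over `n` disks of area of order `r n ^ 2`; this is where `√n r_n → 0` is
essential. -/
lemma tendsto_measureReal_exists_norm_sub_le (hη : ∀ k, Measurable (η k))
    (hlaw : ∀ k, P.map (η k) = μ) (hp0 : ∀ z, 0 ≤ p z)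
    (hμ : μ = volume.withDensity fun z => ENNReal.ofReal (p z)) (hu : ContinuousAt p u)
    (hr0 : ∀ n, 1 ≤ n → 0 < r n) (hr : Tendsto (fun n : ℕ => √(n : ℝ) * r n) atTop (𝓝 0)) :
    Tendsto (fun n : ℕ => P.real {ω | ∃ k < n, ‖u - η k ω‖ ≤ 2 * r n}) atTop (𝓝 0) := by
  obtain ⟨δ, hδ, M, hM0, hM⟩ := exists_density_le_of_continuousAt hp0 hu
  have hlim : Tendsto (fun n : ℕ => M * Real.pi * 4 * (√(n : ℝ) * r n) ^ 2) atTop (𝓝 0) := by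
    simpa using (hr.pow 2).const_mul (M * Real.pi * 4)
  refine squeeze_zero' (Eventually.of_forall fun n => measureReal_nonneg) ?_ hlim
  filter_upwards [hr.eventually_lt_const (half_pos hδ), eventually_ge_atTop 1] with n hn hn1
  have hrn := hr0 n hn1
  have hs1 : 1 ≤ √(n : ℝ) := Real.one_le_sqrt.2 (by exact_mod_cast hn1)
  have hlt : 2 * r n < δ := by nlinarith
  have hset : {ω | ∃ k < n, ‖u - η k ω‖ ≤ 2 * r n}
      = ⋃ k ∈ Finset.range n, η k ⁻¹' closedBall u (2 * r n) := by
    ext ω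
    simp [dist_eq_norm, norm_sub_rev]
  rw [hset]
  calc P.real (⋃ k ∈ Finset.range n, η k ⁻¹' closedBall u (2 * r n))
      ≤ ∑ k ∈ Finset.range n, P.real (η k ⁻¹' closedBall u (2 * r n)) :=
        measureReal_biUnion_finset_le _ _
    _ = ∑ k ∈ Finset.range n, μ.real (closedBall u (2 * r n)) := by
        refine Finset.sum_congr rfl fun k _ => ?_
        rw [← hlaw k, map_measureReal_apply (hη k) measurableSet_closedBall]
    _ ≤ ∑ k ∈ Finset.range n, M * (Real.pi * (2 * r n) ^ 2) :=
        Finset.sum_le_sum fun k _ => measureReal_closedBall_le hμ hM0 hM (by positivity) hlt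
    _ = M * Real.pi * 4 * (√(n : ℝ) * r n) ^ 2 := by
        rw [mul_pow √(n : ℝ), Real.sq_sqrt n.cast_nonneg]
        simp
        ring

variable [IsProbabilityMeasure P] [IsProbabilityMeasure μ]

/-- The summands may have infinite mean, so Markov's inequality is applied to the `9/10` powers: by
subadditivity the event forces `∑ |η_k - u|^(-9/5) ≥ n^(9/8)`, while the left side has mean `C n`.
The probability is at most `C n^(-1/8)`. -/
lemma tendsto_measureReal_sum_sq_gt (hη : ∀ k, Measurable (η k))
    (hlaw : ∀ k, P.map (η k) = μ) (hp0 : ∀ z, 0 ≤ p z)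
    (hμ : μ = volume.withDensity fun z => ENNReal.ofReal (p z)) (hu : ContinuousAt p u) :
    Tendsto (fun n : ℕ => P.real {ω | (n : ℝ) ^ (5 / 4 : ℝ) <
      ∑ k ∈ Finset.range n, (‖u - η k ω‖⁻¹) ^ 2}) atTop (𝓝 0) := by
  obtain ⟨δ, hδ, M, hM0, hM⟩ := exists_density_le_of_continuousAt hp0 hu
  have hI := integrable_rpow_norm_sub hμ hδ hM0 hM (r := -(9 / 5)) (by norm_num) (by norm_num)
  set C := ∫ x, ‖x - u‖ ^ (-(9 / 5) : ℝ) ∂μ with hC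
  have hIk : ∀ k, Integrable (fun ω => ‖η k ω - u‖ ^ (-(9 / 5) : ℝ)) P := by
    intro k
    rw [← hlaw k] at hI
    exact hI.comp_measurable (hη k)
  have hCk : ∀ k, ∫ ω, ‖η k ω - u‖ ^ (-(9 / 5) : ℝ) ∂P = C := by
    intro k
    rw [hC, ← hlaw k, integral_map (hη k).aemeasurable
      (Measurable.pow_const (by fun_prop) _).aestronglyMeasurable]
  have hlim : Tendsto (fun n : ℕ => C * (n : ℝ) ^ (-(1 / 8) : ℝ)) atTop (𝓝 0) := by
    simpa using ((tendsto_rpow_neg_atTop (by norm_num : (0 : ℝ) < 1 / 8)).comp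
      tendsto_natCast_atTop_atTop).const_mul C
  refine squeeze_zero' (Eventually.of_forall fun n => measureReal_nonneg) ?_ hlim
  filter_upwards [eventually_ge_atTop 1] with n hn
  have hn0 : (0 : ℝ) < n := by exact_mod_cast hn
  have hsub : {ω | (n : ℝ) ^ (5 / 4 : ℝ) < ∑ k ∈ Finset.range n, (‖u - η k ω‖⁻¹) ^ 2}
      ⊆ {ω | (n : ℝ) ^ (9 / 8 : ℝ) ≤ ∑ k ∈ Finset.range n, ‖η k ω - u‖ ^ (-(9 / 5) : ℝ)} := by
    intro ω (hω : (n : ℝ) ^ (5 / 4 : ℝ) < ∑ k ∈ Finset.range n, (‖u - η k ω‖⁻¹) ^ 2)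
    have h1 := sum_rpow_le_sum_rpow (Finset.range n) (g := fun k => (‖u - η k ω‖⁻¹) ^ 2)
      (fun k _ => by positivity) (q := 9 / 10) (by norm_num) (by norm_num)
    have h2 : ((n : ℝ) ^ (5 / 4 : ℝ)) ^ (9 / 10 : ℝ) = (n : ℝ) ^ (9 / 8 : ℝ) := by
      rw [← Real.rpow_mul hn0.le]
      norm_num
    have h3 : ∀ k, ((‖u - η k ω‖⁻¹) ^ 2) ^ (9 / 10 : ℝ) = ‖η k ω - u‖ ^ (-(9 / 5) : ℝ) := by
      intro k
      rw [norm_sub_rev, ← Real.rpow_natCast, ← Real.rpow_mul (by positivity),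
        Real.inv_rpow (norm_nonneg _), ← Real.rpow_neg (norm_nonneg _)]
      norm_num
    simp only [h3] at h1
    refine le_trans ?_ h1
    rw [← h2]
    gcongr
  have hmarkov := mul_meas_ge_le_integral_of_nonneg (μ := P)
    (f := fun ω => ∑ k ∈ Finset.range n, ‖η k ω - u‖ ^ (-(9 / 5) : ℝ))
    (ae_of_all _ fun ω => Finset.sum_nonneg fun k _ => by positivity)
    (integrable_finsetSum _ fun k _ => hIk k) ((n : ℝ) ^ (9 / 8 : ℝ))
  rw [integral_finsetSum _ fun k _ => hIk k] at hmarkov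
  simp only [hCk, Finset.sum_const, Finset.card_range, nsmul_eq_mul] at hmarkov
  refine (measureReal_mono hsub).trans ?_
  rw [mul_comm, ← le_div_iff₀ (by positivity)] at hmarkov
  refine hmarkov.trans_eq ?_
  rw [mul_comm, mul_div_assoc]
  congr 1
  nth_rewrite 1 [← Real.rpow_one (n : ℝ)]
  rw [← Real.rpow_sub hn0]
  norm_num

/-- Only a first moment is available in general, so the strong law is used in place of Chebyshev's
inequality. -/
lemma tendsto_measureReal_sum_sub_gt (hη : ∀ k, Measurable (η k)) (hindep : iIndepFun η P)
    (hlaw : ∀ k, P.map (η k) = μ) (hp0 : ∀ z, 0 ≤ p z)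
    (hμ : μ = volume.withDensity fun z => ENNReal.ofReal (p z)) (hu : ContinuousAt p u)
    {f : ℂ} (hf : f = ∫ x, (u - x)⁻¹ ∂μ) (hf0 : f ≠ 0) {ε : ℝ} (hε : 0 < ε) :
    Tendsto (fun n : ℕ => P.real {ω | ε * ‖n * f‖ <
      ‖∑ k ∈ Finset.range n, (u - η k ω)⁻¹ - n * f‖}) atTop (𝓝 0) := by
  obtain ⟨δ, hδ, M, hM0, hM⟩ := exists_density_le_of_continuousAt hp0 hu
  have hIZ : Integrable (fun x => (u - x)⁻¹) μ := by
    refine (integrable_inv_norm_sub hμ hδ hM0 hM).mono' (by fun_prop) (ae_of_all _ fun x => ?_)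
    rw [norm_inv, norm_sub_rev]
  have hgm : Measurable fun x : ℂ => (u - x)⁻¹ := by fun_prop
  have hident : ∀ i, IdentDistrib (fun ω => (u - η i ω)⁻¹) (fun ω => (u - η 0 ω)⁻¹) P P :=
    fun i => IdentDistrib.comp (u := fun x : ℂ => (u - x)⁻¹)
      ⟨(hη i).aemeasurable, (hη 0).aemeasurable, by rw [hlaw, hlaw]⟩ hgm
  have hI0 : Integrable (fun ω => (u - η 0 ω)⁻¹) P := by
    rw [← hlaw 0] at hIZ
    exact hIZ.comp_measurable (hη 0)
  have hslln := strong_law_ae (μ := P) (fun k ω => (u - η k ω)⁻¹) hI0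
    (fun i j hij => ((hindep.indepFun hij).comp hgm hgm)) hident
  have hmean : ∫ ω, (u - η 0 ω)⁻¹ ∂P = f := by
    rw [hf, ← hlaw 0, integral_map (hη 0).aemeasurable (by fun_prop)]
  rw [hmean] at hslln
  have hmeas := tendstoInMeasure_of_tendsto_ae (fun n => by fun_prop) hslln
  rw [tendstoInMeasure_iff_measureReal_norm] at hmeas
  have h := hmeas (ε * ‖f‖) (by positivity)
  refine squeeze_zero' (Eventually.of_forall fun n => measureReal_nonneg) ?_ h
  filter_upwards [eventually_ge_atTop 1] with n hn
  have hn0 : (0 : ℝ) < n := by exact_mod_cast hn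
  refine measureReal_mono fun ω hω => ?_
  have hω' : ε * ‖n * f‖ < ‖∑ k ∈ Finset.range n, (u - η k ω)⁻¹ - n * f‖ := hω
  have e : (n : ℝ)⁻¹ • (∑ k ∈ Finset.range n, (u - η k ω)⁻¹) - f
      = (n : ℝ)⁻¹ • (∑ k ∈ Finset.range n, (u - η k ω)⁻¹ - n * f) := by
    have : (n : ℂ) ≠ 0 := by exact_mod_cast hn0.ne'
    rw [smul_sub]
    simp [this]
  change ε * ‖f‖ ≤ ‖_‖
  rw [e, norm_smul, norm_inv, Real.norm_of_nonneg hn0.le, le_inv_mul_iff₀ hn0]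
  rw [norm_mul, Complex.norm_natCast] at hω'
  linarith

lemma tendsto_measureReal_not_isTypical (hη : ∀ k, Measurable (η k)) (hindep : iIndepFun η P)
    (hlaw : ∀ k, P.map (η k) = μ) (hp0 : ∀ z, 0 ≤ p z)
    (hμ : μ = volume.withDensity fun z => ENNReal.ofReal (p z)) (hu : ContinuousAt p u)
    (hpu : 0 < p u) {f : ℂ → ℂ} (hf : f u = ∫ x, (u - x)⁻¹ ∂μ) (hf0 : f u ≠ 0)
    (hr0 : ∀ n, 1 ≤ n → 0 < r n) (hr_top : Tendsto (fun n : ℕ => (n : ℝ) * r n) atTop atTop)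
    (hr : Tendsto (fun n : ℕ => √(n : ℝ) * r n) atTop (𝓝 0)) {ε : ℝ} (hε : 0 < ε) :
    Tendsto (fun n : ℕ => P.real {ω | ¬ IsTypical p f r ε n u (fun k => η k ω)}) atTop (𝓝 0) := by
  have h1 := tendsto_measureReal_exists_norm_sub_le hη hlaw hp0 hμ hu hr0 hr
  have h2 := tendsto_measureReal_sum_sub_gt hη hindep hlaw hp0 hμ hu hf hf0 hε
  have h3 := tendsto_measureReal_sum_sq_gt hη hlaw hp0 hμ hu
  have hlim := (h1.add h2).add h3
  simp only [add_zero] at hlim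
  have hfn : 0 < ‖f u‖ := norm_pos_iff.2 hf0
  have hneg : Tendsto (fun n : ℕ => (n : ℝ) ^ (-(1 / 4) : ℝ)) atTop (𝓝 0) :=
    (tendsto_rpow_neg_atTop (by norm_num : (0 : ℝ) < 1 / 4)).comp tendsto_natCast_atTop_atTop
  -- The remaining conditions are deterministic: `r_n n^(5/4) = (√n r_n) n^(-1/4) n = o(n)`, `n r_n
  -- → ∞`, and `n^(5/4) = o(n √(n log n))`.
  have hd1 : ∀ᶠ n : ℕ in atTop, 16 * (r n * (n : ℝ) ^ (5 / 4 : ℝ)) ≤ ε * ‖n * f u‖ := by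
    have h := (hr.mul hneg).const_mul 16
    simp only [mul_zero] at h
    filter_upwards [h.eventually_lt_const (by positivity : 0 < ε * ‖f u‖),
      eventually_ge_atTop 1] with n hn hn1
    have hn0 : (0 : ℝ) < n := by exact_mod_cast hn1
    have e : (n : ℝ) ^ (5 / 4 : ℝ) = √(n : ℝ) * (n : ℝ) ^ (-(1 / 4) : ℝ) * n := by
      nth_rewrite 4 [← Real.rpow_one (n : ℝ)]
      rw [Real.sqrt_eq_rpow, ← Real.rpow_add hn0, ← Real.rpow_add hn0]
      norm_num
    rw [e, norm_mul, Complex.norm_natCast]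
    nlinarith
  have hd2 : ∀ᶠ n : ℕ in atTop, 2 ≤ r n * ‖n * f u‖ := by
    filter_upwards [hr_top.eventually_ge_atTop (2 / ‖f u‖)] with n hn
    rw [div_le_iff₀ hfn] at hn
    rw [norm_mul, Complex.norm_natCast]
    linarith
  have hd3 : ∀ᶠ n : ℕ in atTop, 8 * (n : ℝ) ^ (5 / 4 : ℝ) ≤
      ε * (√(Real.pi * p u) * √(n * Real.log n)) * ‖n * f u‖ := by
    have hc : 0 < ε * √(Real.pi * p u) * ‖f u‖ := by positivity
    have h := hneg.const_mul 8
    simp only [mul_zero] at h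
    filter_upwards [h.eventually_lt_const hc, eventually_ge_atTop 3] with n hn hn1
    have hn0 : (0 : ℝ) < n := by exact_mod_cast (by omega : 0 < n)
    have hlog : 1 ≤ Real.log n := by
      rw [Real.le_log_iff_exp_le hn0]
      have : (3 : ℝ) ≤ n := by exact_mod_cast hn1
      linarith [Real.exp_one_lt_d9]
    have hs : √(n : ℝ) ≤ √(n * Real.log n) := by
      gcongr
      nlinarith
    have e : (n : ℝ) ^ (5 / 4 : ℝ) = (n : ℝ) ^ (-(1 / 4) : ℝ) * (√(n : ℝ) * n) := by
      nth_rewrite 4 [← Real.rpow_one (n : ℝ)]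
      rw [Real.sqrt_eq_rpow, ← Real.rpow_add hn0, ← Real.rpow_add hn0]
      norm_num
    rw [e, norm_mul, Complex.norm_natCast]
    calc 8 * ((n : ℝ) ^ (-(1 / 4) : ℝ) * (√(n : ℝ) * n))
        = 8 * (n : ℝ) ^ (-(1 / 4) : ℝ) * (√(n : ℝ) * n) := by ring
      _ ≤ ε * √(Real.pi * p u) * ‖f u‖ * (√(n * Real.log n) * n) := by gcongr
      _ = _ := by ring
  refine squeeze_zero' (Eventually.of_forall fun n => measureReal_nonneg) ?_ hlim
  filter_upwards [hd1, hd2, hd3, eventually_gt_atTop 1] with n e1 e2 e3 e4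
  refine le_trans (measureReal_mono ?_) ((measureReal_union_le _ _).trans
    (add_le_add_left (measureReal_union_le _ _) _))
  intro ω hω
  by_contra hc
  simp only [mem_union, mem_ofPred_eq, not_or, not_exists, not_and, not_lt, not_le] at hc
  exact hω ⟨hc.1.1, hc.1.2, hc.2, e1, e2, e3, e4⟩

end TypicalConfigurations

/-! ### Removing the conditioning on the value of `ξ 0` -/

section Mixture

open Metric Set
open scoped RealInnerProductSpace

lemma indepFun_zero_shift {Ω E : Type*} [MeasurableSpace Ω] [MeasurableSpace E]
    {P : Measure Ω} {ξ : ℕ → Ω → E} (hξ : ∀ k, Measurable (ξ k)) (hindep : iIndepFun ξ P) :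
    IndepFun (ξ 0) (fun ω k => ξ (k + 1) ω) P := by
  have hprob := hindep.isProbabilityMeasure
  refine IndepFun.indepFun_process (hξ 0) (fun k => hξ (k + 1)) fun J => ?_
  have hdisj : Disjoint ({0} : Finset ℕ) (J.map (addRightEmbedding 1)) := by simp
  have h := hindep.indepFun_finset _ _ hdisj hξ
  have h0 : Measurable fun g : (({0} : Finset ℕ) → E) => g ⟨0, by simp⟩ := by fun_prop
  have hJ : Measurable fun (g : (J.map (addRightEmbedding 1) → E)) (j : J) =>
      g ⟨j + 1, by simp⟩ := by fun_prop
  exact h.comp h0 hJ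

section

variable {Ω E F : Type*} [MeasurableSpace Ω] [MeasurableSpace E] {P : Measure Ω}
  [IsProbabilityMeasure P] [MeasurableSpace F] {X : Ω → E} {Y : Ω → F}

/-- If `𝔼 G n (u, Y)` converges to `c` for almost all values `u` of an independent variable `X`,
then `𝔼 G n (X, Y)` converges to `c`. -/
lemma tendsto_integral_of_indepFun (hX : Measurable X) (hY : Measurable Y) (hXY : IndepFun X Y P)
    {V : Type*} [NormedAddCommGroup V] [NormedSpace ℝ V] [CompleteSpace V] {G : ℕ → E × F → V}
    (hG : ∀ n, StronglyMeasurable (G n)) (hb : ∀ n x, ‖G n x‖ ≤ 1) {c : V}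
    (hlim : ∀ᵐ u ∂(P.map X), Tendsto (fun n => ∫ ω, G n (u, Y ω) ∂P) atTop (𝓝 c)) :
    Tendsto (fun n => ∫ ω, G n (X ω, Y ω) ∂P) atTop (𝓝 c) := by
  have := Measure.isProbabilityMeasure_map (μ := P) hX.aemeasurable
  have := Measure.isProbabilityMeasure_map (μ := P) hY.aemeasurable
  -- Independence and Fubini express the expectation as an average over `u` of quantities bounded by
  -- one; dominated convergence then applies.
  have e : ∀ n, ∫ ω, G n (X ω, Y ω) ∂P = ∫ u, ∫ ω, G n (u, Y ω) ∂P ∂(P.map X) := by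
    intro n
    have h1 : ∫ ω, G n (X ω, Y ω) ∂P = ∫ x, G n x ∂(P.map fun ω => (X ω, Y ω)) :=
      (integral_map (hX.prodMk hY).aemeasurable (hG n).aestronglyMeasurable).symm
    have hI : Integrable (G n) ((P.map X).prod (P.map Y)) :=
      (integrable_const (1 : ℝ)).mono' (hG n).aestronglyMeasurable (ae_of_all _ (hb n))
    rw [h1, hXY.map_prod_eq_prod_map_map hX.aemeasurable hY.aemeasurable, integral_prod _ hI]
    refine integral_congr_ae (ae_of_all _ fun u => ?_)
    exact integral_map hY.aemeasurable ((hG n).comp_measurable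
      measurable_prodMk_left).aestronglyMeasurable
  simp_rw [e]
  have hc : c = ∫ _u, c ∂(P.map X) := by simp
  rw [hc]
  refine tendsto_integral_of_dominated_convergence (fun _ => 1) (fun n => ?_)
    (integrable_const _) (fun n => ae_of_all _ fun u => ?_) hlim
  · have : StronglyMeasurable fun x : E × Ω => G n (x.1, Y x.2) :=
      (hG n).comp_measurable (by fun_prop)
    exact this.integral_prod_right.aestronglyMeasurable
  · refine (norm_integral_le_of_norm_le (integrable_const (1 : ℝ))
      (ae_of_all _ fun ω => hb n _)).trans ?_
    simp

lemma tendsto_measureReal_of_indepFun (hX : Measurable X) (hY : Measurable Y)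
    (hXY : IndepFun X Y P) {A : ℕ → Set (E × F)} (hA : ∀ n, MeasurableSet (A n)) {c : ℝ}
    (hlim : ∀ᵐ u ∂(P.map X), Tendsto (fun n => P.real {ω | (u, Y ω) ∈ A n}) atTop (𝓝 c)) :
    Tendsto (fun n => P.real {ω | (X ω, Y ω) ∈ A n}) atTop (𝓝 c) := by
  have key : ∀ (n : ℕ) (Z : Ω → E), Measurable Z →
      ∫ ω, (A n).indicator (fun _ => (1 : ℝ)) (Z ω, Y ω) ∂P = P.real {ω | (Z ω, Y ω) ∈ A n} := by
    intro n Z hZ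
    have h := (hZ.prodMk hY) (hA n)
    exact integral_indicator_one h
  have h := tendsto_integral_of_indepFun hX hY hXY
    (G := fun n => (A n).indicator fun _ => (1 : ℝ))
    (fun n => stronglyMeasurable_const.indicator (hA n)) (fun n x => by
      refine (norm_indicator_le_norm_self _ _).trans ?_
      simp) (c := c) (by
      filter_upwards [hlim] with u hu
      exact hu.congr fun n => (key n (fun _ => u) measurable_const).symm)
  exact h.congr fun n => key n X hX

end

lemma charFun_complexNormal_one (t : ℂ) :
    charFun (complexNormal 1) t = Complex.exp (-(‖t‖ ^ 2 / 4 : ℝ)) := by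
  have h : ∀ x : ℝ × ℝ, Complex.exp ((⟪(x.1 : ℂ) + x.2 * Complex.I, t⟫ : ℝ) * Complex.I)
      = Complex.exp ((⟪x.1, t.re⟫ : ℝ) * Complex.I) * Complex.exp ((⟪x.2, t.im⟫ : ℝ) * Complex.I) := by
    intro x
    rw [← Complex.exp_add]
    simp [Complex.inner]
    ring_nf
  rw [complexNormal, charFun_apply, integral_map (by fun_prop) (by fun_prop)]
  simp_rw [h]
  rw [integral_prod_mul (fun x : ℝ => Complex.exp ((⟪x, t.re⟫ : ℝ) * Complex.I))
    (fun x : ℝ => Complex.exp ((⟪x, t.im⟫ : ℝ) * Complex.I)), ← charFun_apply, ← charFun_apply,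
    charFun_gaussianReal, charFun_gaussianReal, ← Complex.exp_add, Complex.sq_norm,
    Complex.normSq_apply]
  congr 1
  push_cast
  ring

/-- The normalized fluctuation of `∑ 1 / (u - b k)` around `n f(u)`. -/
noncomputable def fluctuation (p : ℂ → ℝ) (f : ℂ → ℂ) (n : ℕ) (u : ℂ) (b : ℕ → ℂ) : ℂ :=
  (√(Real.pi * p u) * √(n * Real.log n))⁻¹ • (∑ k ∈ Finset.range n, (u - b k)⁻¹ - n * f u)

lemma measurable_fluctuation {p : ℂ → ℝ} (hp : Measurable p) {f : ℂ → ℂ} (hf : Measurable f)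
    (n : ℕ) : Measurable fun x : ℂ × (ℕ → ℂ) => fluctuation p f n x.1 x.2 := by
  have hsum : Measurable fun x : ℂ × (ℕ → ℂ) => ∑ k ∈ Finset.range n, (x.1 - x.2 k)⁻¹ :=
    Finset.measurable_fun_sum _ fun k _ => by fun_prop
  unfold fluctuation
  fun_prop

section

variable {Ω : Type*} [MeasurableSpace Ω] {P : Measure Ω} {μ : Measure ℂ}
  [IsProbabilityMeasure μ] {p : ℂ → ℝ} {f : ℂ → ℂ}

lemma tendsto_charFun_fluctuation {η : ℕ → Ω → ℂ} (hη : ∀ k, Measurable (η k))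
    (hindep : iIndepFun η P) (hlaw : ∀ k, P.map (η k) = μ) (hp0 : ∀ z, 0 ≤ p z)
    (hpm : Measurable p) (hμ : μ = volume.withDensity fun z => ENNReal.ofReal (p z)) {u : ℂ}
    (hu : ContinuousAt p u) (hpu : 0 < p u) (hf : f u = ∫ x, (u - x)⁻¹ ∂μ) (t : ℂ) :
    Tendsto (fun n : ℕ => ∫ ω, Complex.exp
        ((⟪fluctuation p f n u (fun k => η k ω), t⟫ : ℝ) * Complex.I) ∂P) atTop
      (𝓝 (Complex.exp (-(‖t‖ ^ 2 / 4 : ℝ)))) := by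
  refine (tendsto_integral_exp_inner_inv_sub_pow hp0 hpm hμ hu hpu t).congr fun n => ?_
  rw [← hf]
  set a := √(Real.pi * p u) * √(n * Real.log n) with ha
  set g : ℂ → ℂ := fun x => a⁻¹ • ((u - x)⁻¹ - f u) with hg
  have hgm : Measurable g := by fun_prop
  have hsum : ∀ ω, fluctuation p f n u (fun k => η k ω) = ∑ k ∈ Finset.range n, g (η k ω) := by
    intro ω
    simp only [fluctuation, hg]
    rw [← Finset.smul_sum, Finset.sum_sub_distrib]
    simp [ha]
  have hcf := iIndepFun.charFun_map_fun_finsetSum_eq_prod (s := Finset.range n)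
    (X := fun k ω => g (η k ω)) (P := P) (fun k _ => (hgm.comp (hη k)).aemeasurable)
    ((hindep.comp (fun _ => g) fun _ => hgm).restrict _)
  have hcf := congrFun hcf t
  rw [Finset.prod_apply] at hcf
  have h1 : charFun (P.map fun ω => ∑ k ∈ Finset.range n, g (η k ω)) t
      = ∫ ω, Complex.exp ((⟪fluctuation p f n u (fun k => η k ω), t⟫ : ℝ) * Complex.I) ∂P := by
    rw [charFun_apply, integral_map (by fun_prop) (by fun_prop)]
    simp_rw [hsum]
  have h2 : ∀ k, charFun (P.map fun ω => g (η k ω)) t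
      = ∫ x, Complex.exp ((⟪(u - x)⁻¹ - f u, t⟫ / a : ℝ) * Complex.I) ∂μ := by
    intro k
    rw [charFun_apply, integral_map (by fun_prop) (by fun_prop), ← hlaw k,
      integral_map (by fun_prop) (by fun_prop)]
    refine integral_congr_ae (ae_of_all _ fun ω => ?_)
    simp only [hg, real_inner_smul_left]
    rw [div_eq_inv_mul]
  simp only [h2, Finset.prod_const, Finset.card_range] at hcf
  rw [← h1, hcf]

/-- The factor `√(π p(u))` makes the conditional limit the same for almost every `u`, so the
characteristic functions converge unconditionally. -/
lemma tendstoInDistribution_fluctuation [IsProbabilityMeasure P] {ξ : ℕ → Ω → ℂ} (hξ : ∀ k, Measurable (ξ k))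
    (hindep : iIndepFun ξ P) (hlaw : ∀ k, P.map (ξ k) = μ) (hp0 : ∀ z, 0 ≤ p z)
    (hpm : Measurable p) (hμ : μ = volume.withDensity fun z => ENNReal.ofReal (p z))
    (hfm : Measurable f) (hu : ∀ᵐ u ∂μ, ContinuousAt p u ∧ 0 < p u)
    (hf : ∀ u, f u = ∫ x, (u - x)⁻¹ ∂μ) :
    TendstoInDistribution (fun (n : ℕ) ω => fluctuation p f n (ξ 0 ω) (fun k => ξ (k + 1) ω))
      atTop (id : ℂ → ℂ) (fun _ => P) (complexNormal 1) := by
  have hη : Measurable fun ω k => ξ (k + 1) ω := measurable_pi_lambda _ fun k => hξ (k + 1)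
  have hm : ∀ n, Measurable fun ω => fluctuation p f n (ξ 0 ω) (fun k => ξ (k + 1) ω) :=
    fun n => (measurable_fluctuation hpm hfm n).comp ((hξ 0).prodMk hη)
  refine ⟨fun n => (hm n).aemeasurable, aemeasurable_id, ?_⟩
  refine ProbabilityMeasure.tendsto_iff_tendsto_charFun.2 fun t => ?_
  simp only [ProbabilityMeasure.coe_mk, Measure.map_id, charFun_complexNormal_one]
  have h := tendsto_integral_of_indepFun (hξ 0) hη (indepFun_zero_shift hξ hindep)
    (G := fun n x => Complex.exp ((⟪fluctuation p f n x.1 x.2, t⟫ : ℝ) * Complex.I))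
    (c := Complex.exp (-(‖t‖ ^ 2 / 4 : ℝ))) (fun n => by
      have := measurable_fluctuation hpm hfm n
      exact Measurable.stronglyMeasurable (by fun_prop))
    (fun n x => by rw [Complex.norm_exp_ofReal_mul_I]) (by
      rw [hlaw 0]
      filter_upwards [hu] with u hu
      exact tendsto_charFun_fluctuation (fun k => hξ (k + 1))
        (hindep.precomp (add_left_injective 1)) (fun k => hlaw (k + 1)) hp0 hpm hμ hu.1 hu.2
        (hf u) t)
  refine h.congr fun n => ?_
  rw [charFun_apply, integral_map (hm n).aemeasurable (by fun_prop)]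

end

end Mixture

/-! ### From the fluctuation of the sum to that of the critical point -/

section FluctuationOfCriticalPoint

open Metric Set

variable {p : ℂ → ℝ} {f : ℂ → ℂ} {r : ℕ → ℝ} {ε : ℝ} {n : ℕ} {a : ℕ → ℂ}

lemma IsTypical.existsUnique (h : IsTypical p f r ε n (a 0) fun k => a (k + 1)) (hr : 0 < r n)
    (hε : ε ≤ 1 / 4) : ∃! ζ, IsCriticalPointNear a n (r n) ζ := by
  refine existsUnique_isCriticalPointNear hr h.separated hε h.sum_close ?_ h.le_radius
  refine le_trans ?_ h.radius_le
  have := h.sum_sq_le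
  gcongr

/-- With `w = ζ - a 0 = -1/S`, one has `-(n f w) = n f / S`, close to `1`. The rescaled quantity
equals `n f / S` times the normalized `S - n f`; replacing `S = S(ζ)` by `S(a 0)` costs the small
Lipschitz term. -/
lemma IsTypical.norm_sub_one_le_and_norm_sub_le
    (h : IsTypical p f r ε n (a 0) fun k => a (k + 1)) (hr : 0 < r n)
    (hε0 : 0 < ε) (hε : ε ≤ 1 / 4) {ζ : ℂ} (hζ : IsCriticalPointNear a n (r n) ζ) :
    ‖-(n * f (a 0) * (ζ - a 0)) - 1‖ ≤ 4 * ε ∧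
      ‖f (a 0) ^ 2 / (√(Real.pi * p (a 0)) : ℂ) * (√((n : ℝ) / Real.log n) : ℂ) *
          ((n : ℂ) * (ζ - a 0) + 1 / f (a 0))
        - -(n * f (a 0) * (ζ - a 0)) * fluctuation p f n (a 0) fun k => a (k + 1)‖ ≤ 2 * ε := by
  have hV := h.sum_sq_le
  have hrV : 16 * (r n * ∑ k ∈ Finset.range n, (‖a 0 - a (k + 1)‖⁻¹) ^ 2) ≤ ε * ‖n * f (a 0)‖ := by
    refine le_trans ?_ h.radius_le
    gcongr
  obtain ⟨hw, hS⟩ := (isCriticalPointNear_iff hr h.separated ζ).1 hζ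
  have hclose := norm_sum_inv_sub_le hr h.separated h.sum_close hrV hw
  have hlip := norm_sum_inv_sub_sum_inv_le (Finset.range n) (fun k => a (k + 1)) (u := a 0)
    (z := ζ) (z' := a 0) (fun k hk => h.separated k (Finset.mem_range.1 hk)) hw
    (by simpa using hr.le)
  unfold fluctuation
  set S := ∑ k ∈ Finset.range n, (ζ - a (k + 1))⁻¹
  set S₀ := ∑ k ∈ Finset.range n, (a 0 - a (k + 1))⁻¹
  set V := ∑ k ∈ Finset.range n, (‖a 0 - a (k + 1)‖⁻¹) ^ 2
  set c := f (a 0)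
  set w := ζ - a 0
  have hn1 : (1 : ℝ) < n := by exact_mod_cast h.one_lt
  have hn0 : (0 : ℝ) < n := zero_lt_one.trans hn1
  have hlog : 0 < Real.log n := Real.log_pos hn1
  have hF0 : 0 < ‖n * c‖ := by
    by_contra h0
    have h2 := h.le_radius
    rw [le_antisymm (not_lt.1 h0) (norm_nonneg _)] at h2
    linarith
  have hnc : (n : ℂ) ≠ 0 := by exact_mod_cast hn0.ne'
  have hc0 : c ≠ 0 := fun h0 => by simp [h0] at hF0
  -- If the square root vanished, the right side of `error_le` would be zero while its left side is
  -- positive.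
  have hp : 0 < √(Real.pi * p (a 0)) := by
    by_contra h0
    have h2 := h.error_le
    rw [le_antisymm (not_lt.1 h0) (Real.sqrt_nonneg _)] at h2
    have : (0 : ℝ) < (n : ℝ) ^ (5 / 4 : ℝ) := by positivity
    simp at h2
    linarith
  have hs : 0 < √(n * Real.log n) := by positivity
  have hSlow : ‖n * c‖ / 2 ≤ ‖S‖ := by
    have h2 := norm_sub_norm_le (n * c) S
    rw [norm_sub_rev] at h2
    nlinarith
  have hS0 : S ≠ 0 := norm_pos_iff.1 (by linarith)
  have hwS : w = -S⁻¹ := by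
    rw [show -S⁻¹ = -1 / S by ring, eq_div_iff hS0]
    exact hS
  have hρ : -(n * c * w) = n * c / S := by rw [hwS]; ring
  have hρ1 : ‖n * c / S - 1‖ ≤ 4 * ε := by
    rw [div_sub_one hS0, norm_div, norm_sub_rev, div_le_iff₀ (norm_pos_iff.2 hS0)]
    nlinarith
  have hρ2 : ‖n * c / S‖ ≤ 2 := by
    have h2 := norm_sub_norm_le (n * c / S) 1
    rw [norm_one] at h2
    linarith
  have hwn : ‖w‖ ≤ 2 / ‖n * c‖ := by
    rw [hwS, norm_neg, norm_inv, inv_le_comm₀ (by linarith) (by positivity), inv_div]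
    exact hSlow
  refine ⟨by rw [hρ]; exact hρ1, ?_⟩
  have hsqrt : √((n : ℝ) / Real.log n) = n / √(n * Real.log n) := by
    rw [eq_div_iff hs.ne', ← Real.sqrt_mul (by positivity)]
    rw [show (n : ℝ) / Real.log n * (n * Real.log n) = n ^ 2 by field_simp]
    exact Real.sqrt_sq hn0.le
  have e : c ^ 2 / (√(Real.pi * p (a 0)) : ℂ) * (√((n : ℝ) / Real.log n) : ℂ) * (n * w + 1 / c)
      - -(n * c * w) * ((√(Real.pi * p (a 0)) * √(n * Real.log n))⁻¹ • (S₀ - n * c))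
      = n * c / S * ((√(Real.pi * p (a 0)) * √(n * Real.log n))⁻¹ • (S - S₀)) := by
    have h1 : (√(Real.pi * p (a 0)) : ℂ) ≠ 0 := by exact_mod_cast hp.ne'
    have h2 : (√(n * Real.log n) : ℂ) ≠ 0 := by exact_mod_cast hs.ne'
    rw [hρ, hwS, hsqrt, Complex.real_smul, Complex.real_smul]
    push_cast
    field_simp
    ring
  rw [e, norm_mul, norm_smul, norm_inv, Real.norm_of_nonneg (by positivity)]
  -- The bound `|w| ≤ 2 / ‖n f‖`, sharper than `|w| ≤ r n`, is what brings this difference below the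
  -- scale `√(n log n)`.
  have hdiff : ‖S - S₀‖ ≤ ε * (√(Real.pi * p (a 0)) * √(n * Real.log n)) := by
    calc ‖S - S₀‖ ≤ 4 * V * ‖w‖ := hlip
      _ ≤ 4 * (n : ℝ) ^ (5 / 4 : ℝ) * (2 / ‖n * c‖) := by gcongr
      _ = 8 * (n : ℝ) ^ (5 / 4 : ℝ) / ‖n * c‖ := by ring
      _ ≤ _ := by
        rw [div_le_iff₀ hF0]
        exact h.error_le
  have hdiff' : (√(Real.pi * p (a 0)) * √(n * Real.log n))⁻¹ * ‖S - S₀‖ ≤ ε := by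
    rw [inv_mul_le_iff₀ (by positivity)]
    linarith
  gcongr

end FluctuationOfCriticalPoint

/-! ### Assembly of the theorem -/

lemma measurable_of_continuousOn_of_eq_zero {D : Set ℂ} (hD : IsOpen D) {p : ℂ → ℝ}
    (hp : ContinuousOn p D) (hp0 : ∀ z, z ∉ D → p z = 0) : Measurable p := by
  classical
  have h := hp.measurable_piecewise (g := fun _ => (0 : ℝ)) continuousOn_const hD.measurableSet
  convert h using 1
  ext z
  by_cases hz : z ∈ D <;> simp [hz, hp0]

lemma measurable_cauchyStieltjes {Ω : Type*} [MeasurableSpace Ω] {P : Measure Ω} [SFinite P]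
    {X : Ω → ℂ} (hX : Measurable X) : Measurable (cauchyStieltjes P X) := by
  have h : StronglyMeasurable fun x : ℂ × Ω => 1 / (x.1 - X x.2) :=
    Measurable.stronglyMeasurable (by fun_prop)
  exact h.integral_prod_right.measurable

lemma tendstoInMeasure_of_forall_subset {Ω ι E : Type*} [MeasurableSpace Ω] {P : Measure Ω}
    [IsFiniteMeasure P] [SeminormedAddCommGroup E] {l : Filter ι} {X : ι → Ω → E} {Z : Ω → E}
    {B : ℝ → ι → Set Ω} (hB : ∀ ε, 0 < ε → Tendsto (fun n => P.real (B ε n)) l (𝓝 0))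
    {C : ℝ} (hC : 0 < C)
    (h : ∀ ε, 0 < ε → ε ≤ 1 / 4 → ∀ᶠ n in l, ∀ ω ∉ B ε n, ‖X n ω - Z ω‖ ≤ C * ε) :
    TendstoInMeasure P X l Z := by
  rw [tendstoInMeasure_iff_measureReal_norm]
  intro δ hδ
  -- This choice keeps `ε ≤ 1 / 4` and makes `C * ε ≤ δ / 2 < δ`.
  have hε : 0 < min (1 / 4) (δ / (2 * C)) := by positivity
  refine squeeze_zero' (Eventually.of_forall fun n => measureReal_nonneg) ?_ (hB _ hε)
  filter_upwards [h _ hε (min_le_left _ _)] with n hn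
  refine measureReal_mono fun ω (hω : δ ≤ ‖X n ω - Z ω‖) => ?_
  by_contra hc
  have h1 := hω.trans (hn ω hc)
  have h2 : C * min (1 / 4) (δ / (2 * C)) ≤ C * (δ / (2 * C)) := by
    gcongr
    exact min_le_right _ _
  have h3 : C * (δ / (2 * C)) = δ / 2 := by field_simp
  linarith

theorem theorem2p1 {Ω : Type*} [MeasurableSpace Ω] (P : Measure Ω) [IsProbabilityMeasure P]
    -- i.i.d. complex random variables with Lebesgue density `p`
    (ξ : ℕ → Ω → ℂ) (hξ_meas : ∀ k, Measurable (ξ k)) (hξ_indep : iIndepFun ξ P)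
    (p : ℂ → ℝ) (hp_nonneg : ∀ z, 0 ≤ p z)
    (hξ_density : ∀ k, P.map (ξ k) = volume.withDensity (fun z => ENNReal.ofReal (p z)))
    -- the density is continuous on the open set `D` and vanishes off `D`
    (D : Set ℂ) (hD : IsOpen D) (hp_cont : ContinuousOn p D) (hp_zero : ∀ z, z ∉ D → p z = 0)
    (hf : ∀ᵐ z ∂(volume : Measure ℂ), z ∈ D → cauchyStieltjes P (ξ 1) z ≠ 0)
    (r : ℕ → ℝ) (hr_pos : ∀ n, 1 ≤ n → 0 < r n)
    (hr_top : Tendsto (fun n : ℕ => (n : ℝ) * r n) atTop atTop)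
    (hr_zero : Tendsto (fun n : ℕ => √(n : ℝ) * r n) atTop (𝓝 0)) :
    Tendsto (fun n : ℕ => P {ω | ∃! ζ : ℂ, IsCriticalPointNear (fun k => ξ k ω) n (r n) ζ})
      atTop (𝓝 1) ∧
    -- `ζ n` is the critical point where it exists uniquely, and arbitrary otherwise
    ∀ ζ : ℕ → Ω → ℂ, (∀ n, AEMeasurable (ζ n) P) →
      (∀ n, 1 ≤ n → ∀ ω, (∃! z : ℂ, IsCriticalPointNear (fun k => ξ k ω) n (r n) z) →
        IsCriticalPointNear (fun k => ξ k ω) n (r n) (ζ n ω)) →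
      TendstoInDistribution
        (fun (n : ℕ) (ω : Ω) =>
          cauchyStieltjes P (ξ 1) (ξ 0 ω) ^ 2 / (√(Real.pi * p (ξ 0 ω)) : ℂ) *
            (√((n : ℝ) / Real.log n) : ℂ) *
            ((n : ℂ) * (ζ n ω - ξ 0 ω) + 1 / cauchyStieltjes P (ξ 1) (ξ 0 ω)))
        atTop (id : ℂ → ℂ) (fun _ => P) (complexNormal 1) := by
  set f := cauchyStieltjes P (ξ 1) with hf_def
  set μ := P.map (ξ 1) with hμ_def
  have : IsProbabilityMeasure μ := Measure.isProbabilityMeasure_map (hξ_meas 1).aemeasurable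
  have hμ : μ = volume.withDensity fun z => ENNReal.ofReal (p z) := hξ_density 1
  have hlaw : ∀ k, P.map (ξ k) = μ := fun k => (hξ_density k).trans hμ.symm
  have hpm : Measurable p := measurable_of_continuousOn_of_eq_zero hD hp_cont hp_zero
  have hfm : Measurable f := measurable_cauchyStieltjes (hξ_meas 1)
  have hfμ : ∀ u, f u = ∫ x, (u - x)⁻¹ ∂μ := fun u => by
    rw [hμ_def, integral_map (hξ_meas 1).aemeasurable (by fun_prop)]
    simp [hf_def, cauchyStieltjes]
  -- Points with `p u = 0` are null for the law, and every other point lies in `D`, where `p` is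
  -- continuous and `f` vanishes only on a Lebesgue null set.
  have hae : ∀ᵐ u ∂μ, (ContinuousAt p u ∧ 0 < p u) ∧ f u ≠ 0 := by
    rw [hμ, ae_withDensity_iff (by fun_prop)]
    filter_upwards [hf] with u hu hpu
    have hpu' : 0 < p u := by simpa using hpu
    have huD : u ∈ D := by
      by_contra h
      exact hpu'.ne' (hp_zero u h)
    exact ⟨⟨hp_cont.continuousAt (hD.mem_nhds huD), hpu'⟩, hu huD⟩
  have hη : Measurable fun ω k => ξ (k + 1) ω := measurable_pi_lambda _ fun k => hξ_meas (k + 1)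
  have hbad : ∀ ε, 0 < ε → Tendsto (fun n => P.real {ω | ¬ IsTypical p f r ε n (ξ 0 ω)
      fun k => ξ (k + 1) ω}) atTop (𝓝 0) := by
    intro ε hε
    refine tendsto_measureReal_of_indepFun (hξ_meas 0) hη
      (indepFun_zero_shift hξ_meas hξ_indep)
      (A := fun n => {x | IsTypical p f r ε n x.1 x.2}ᶜ)
      (fun n => (measurableSet_isTypical hpm hfm r ε n).compl) ?_
    rw [hlaw 0]
    filter_upwards [hae] with u hu
    exact tendsto_measureReal_not_isTypical (fun k => hξ_meas (k + 1))
      (hξ_indep.precomp (add_left_injective 1)) (fun k => hlaw (k + 1)) hp_nonneg hμ hu.1.1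
      hu.1.2 (hfμ u) hu.2 hr_pos hr_top hr_zero hε
  constructor
  · rw [← ENNReal.tendsto_toReal_iff (fun _ => measure_ne_top _ _) ENNReal.one_ne_top]
    have hlim := (hbad (1 / 4) (by norm_num)).const_sub 1
    rw [sub_zero] at hlim
    refine tendsto_of_tendsto_of_tendsto_of_le_of_le' hlim tendsto_const_nhds ?_
      (Eventually.of_forall fun n => measureReal_le_one)
    filter_upwards [eventually_ge_atTop 1] with n hn
    rw [sub_le_iff_le_add]
    refine (probReal_univ (μ := P)).symm.le.trans ((measureReal_mono fun ω _ => ?_).trans (measureReal_union_le _ _))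
    by_cases h : IsTypical p f r (1 / 4) n (ξ 0 ω) fun k => ξ (k + 1) ω
    · exact Or.inl (IsTypical.existsUnique (a := fun k => ξ k ω) h (hr_pos n hn) le_rfl)
    · exact Or.inr h
  · intro ζ hζm hζ
    have hgood : ∀ ε, 0 < ε → ε ≤ 1 / 4 → ∀ n, 1 ≤ n → ∀ ω,
        (IsTypical p f r ε n (ξ 0 ω) fun k => ξ (k + 1) ω) → _ := fun ε hε0 hε n hn ω h =>
      IsTypical.norm_sub_one_le_and_norm_sub_le (a := fun k => ξ k ω) h (hr_pos n hn) hε0 hε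
        (hζ n hn ω (IsTypical.existsUnique (a := fun k => ξ k ω) h (hr_pos n hn) hε))
    have hfξ : Measurable fun ω => f (ξ 0 ω) := hfm.comp (hξ_meas 0)
    have hpξ : Measurable fun ω => p (ξ 0 ω) := hpm.comp (hξ_meas 0)
    have hY := tendstoInDistribution_fluctuation hξ_meas hξ_indep hlaw hp_nonneg hpm hμ hfm
      (hae.mono fun u hu => hu.1) hfμ
    set Y : ℕ → Ω → ℂ := fun n ω => fluctuation p f n (ξ 0 ω) fun k => ξ (k + 1) ω
    -- On typical configurations this is `n f / S(ζ)`, the factor that Slutsky's theorem replaces by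
    -- `1`.
    set ρ : ℕ → Ω → ℂ := fun n ω => -(n * f (ξ 0 ω) * (ζ n ω - ξ 0 ω)) with hρ_def
    have hξ0 : Measurable (ξ 0) := hξ_meas 0
    have hρm : ∀ n, AEMeasurable (ρ n) P := fun n => by
      have := hζm n
      fun_prop
    have hρ : TendstoInMeasure P ρ atTop fun _ => (1 : ℂ) := by
      refine tendstoInMeasure_of_forall_subset hbad (C := 4) (by norm_num) fun ε hε0 hε => ?_
      filter_upwards [eventually_ge_atTop 1] with n hn ω hω
      exact (hgood ε hε0 hε n hn ω (not_not.1 hω)).1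
    have hslutsky := hY.continuous_comp_prodMk_of_tendstoInMeasure_const
      (g := fun x : ℂ × ℂ => x.2 * x.1) (by fun_prop) hρ hρm
    simp only [one_mul] at hslutsky
    refine tendstoInDistribution_of_tendstoInMeasure_sub _ _ hslutsky ?_ fun n => ?_
    · refine tendstoInMeasure_of_forall_subset hbad (C := 2) (by norm_num) fun ε hε0 hε => ?_
      filter_upwards [eventually_ge_atTop 1] with n hn ω hω
      simpa only [Pi.sub_apply, Pi.zero_apply, sub_zero] using
        (hgood ε hε0 hε n hn ω (not_not.1 hω)).2
    · have := hζm n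
      fun_prop
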